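/- Let $n\ge 1$ and let $(M,\varphi_i,\xi_i,\eta_i,g)_{i=1,2,3}$ be a smooth almost $3$-contact metric manifold of dimension $4n+3$. That is, $g$ is a Riemannian metric, and the $\varphi_i$ ($(1,1)$-tensor fields), $\xi_i$ (vector fields) and $\eta_i$ ($1$-forms) are smooth and satisfy $$\varphi_i^2=-I+\eta_i\otimes\xi_i,\qquad \eta_i(\xi_i)=1,\qquad g(\varphi_iX,\varphi_iY)=g(X,Y)-\eta_i(X)\eta_i(Y),$$ and, for every even permutation $(i,j,k)$ of $(1,2,3)$, $$\varphi_k=\varphi_i\varphi_j-\eta_j\otimes\xi_i=-\varphi_j\varphi_i+\eta_i\otimes\xi_j,\quad \xi_k=\varphi_i\xi_j=-\varphi_j\xi_i,\quad \eta_k=\eta_i\circ\varphi_j=-\eta_j\circ\varphi_i .$$ Put $\Phi_i(X,Y)=g(X,\varphi_iY)$, $\eta_{jk}=\eta_j\wedge\eta_k$, $\eta_{123}=\eta_1\wedge\eta_2\wedge\eta_3$, and let $\Phi_i^{\mathcal H}(X,Y)=\Phi_i(X_{\mathcal H},Y_{\mathcal H})$, where $X_{\mathcal H}=X-\sum_{r=1}^3\eta_r(X)\xi_r$.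 The conventions are $(\eta\wedge\eta')(X,Y)=\eta(X)\eta'(Y)-\eta(Y)\eta'(X)$ and $d\eta(X,Y)=X\eta(Y)-Y\eta(X)-\eta([X,Y])$ for $1$-forms. Assume that $M$ is a $3$-$(\alpha,\delta)$-Sasaki manifold, i.e. there are real constants $\alpha\neq0$ and $\delta$ such that $d\eta_i=2\alpha\Phi_i+2(\alpha-\delta)\,\eta_{jk}$ for every even permutation $(i,j,k)$ of $(1,2,3)$. Then $M$ has exactly one canonical connection $\nabla$, i.e. exactly one metric connection $\nabla$ with totally skew-symmetric torsion for which there is a smooth function $\beta$ with $$\nabla_X\varphi_i=\beta\,(\eta_k(X)\varphi_j-\eta_j(X)\varphi_k)$$ for all vector fields $X$ and every even permutation $(i,j,k)$ of $(1,2,3)$. Its torsion, regarded as the $3$-form $T(X,Y,Z)=g(T(X,Y),Z)$, is $$T=\sum_{i=1}^3\eta_i\wedge d\eta_i+8(\delta-\alpha)\,\eta_{123}=2\alpha\sum_{i=1}^3\eta_i\wedge\Phi_i^{\mathcal H}+2(\delta-4\alpha)\,\eta_{123}.$$ It satisfies $\nabla T=0$, and $$dT=4\alpha^2\sum_{i=1}^3\Phi_i\wedge\Phi_i+8\alpha(\delta-\alpha)\sum_{(i,j,k)}\Phi_i\wedge\eta_{jk}=4\alpha^2\sum_{i=1}^3\Phi_i^{\mathcal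 H}\wedge\Phi_i^{\mathcal H}+8\alpha(\delta-2\alpha)\sum_{(i,j,k)}\Phi_i^{\mathcal H}\wedge\eta_{jk},$$ where $\sum_{(i,j,k)}$ denotes the sum over the three even permutations $(i,j,k)$ of $(1,2,3)$. -/

import Mathlib

open scoped Manifold ContDiff Bundle

/-! ## Exterior product of alternating forms -/

section LinearAlgebra

variable {V : Type*} [AddCommGroup V] [Module ℝ V] [TopologicalSpace V]

/-- The exterior product of two real-valued alternating forms, in the convention
`(a ∧ b)(v₁, …, v_{k+l}) = ∑ sign σ * a(v_{σ 1}, …, v_{σ k}) * b(v_{σ (k+1)}, …, v_{σ (k+l)})`,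
the sum running over all `(k, l)`-shuffles `σ`. -/
noncomputable def altWedge {k l : ℕ} (a : V [⋀^Fin k]→L[ℝ] ℝ) (b : V [⋀^Fin l]→L[ℝ] ℝ) :
    V [⋀^Fin (k + l)]→L[ℝ] ℝ where
  __ := ((LinearMap.mul' ℝ ℝ).compAlternatingMap
    (a.toAlternatingMap.domCoprod b.toAlternatingMap)).domDomCongr finSumFinEquiv
  cont := by
    change Continuous fun v : Fin (k + l) → V ↦
      LinearMap.mul' ℝ ℝ ((∑ s, AlternatingMap.domCoprod.summand a.toAlternatingMap
        b.toAlternatingMap s) (fun i ↦ v (finSumFinEquiv i)))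
    simp only [sum_apply, map_sum]
    refine continuous_finsetSum _ fun s _ ↦ ?_
    induction s using Quotient.inductionOn' with
    | h s =>
      have : Continuous fun v : Fin (k + l) → V ↦ (Equiv.Perm.sign s : ℤ) •
          (a (fun i ↦ v (finSumFinEquiv (s (Sum.inl i)))) *
            b (fun i ↦ v (finSumFinEquiv (s (Sum.inr i))))) := by
        have ha := a.coe_continuous
        have hb := b.coe_continuous
        fun_prop
      convert! this using 2 with v
      rw [AlternatingMap.domCoprod.summand_mk'', Units.smul_def, smul_apply, map_zsmul]
      rfl

end LinearAlgebra

/-! ## Differential forms on a manifold -/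

section Forms

/-- Differential `k`-forms on a manifold `M` modelled on `E`, with no regularity imposed. -/
abbrev DiffForm (E : Type*) [NormedAddCommGroup E] [NormedSpace ℝ E]
    (M : Type*) [TopologicalSpace M] [ChartedSpace E M] (k : ℕ) : Type _ :=
  ∀ x : M, TangentSpace 𝓘(ℝ, E) x [⋀^Fin k]→L[ℝ] ℝ

variable {E : Type*} [NormedAddCommGroup E] [NormedSpace ℝ E]
  {M : Type*} [TopologicalSpace M] [ChartedSpace E M]

namespace DiffForm

/-- A field of linear forms, as a differential `1`-form. -/
noncomputable def ofCovector (η : ∀ x : M, TangentSpace 𝓘(ℝ, E) x →L[ℝ] ℝ) : DiffForm E M 1 :=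
  fun x ↦ ContinuousAlternatingMap.ofSubsingleton ℝ (TangentSpace 𝓘(ℝ, E) x) ℝ (0 : Fin 1) (η x)

/-- The exterior product of differential forms. -/
noncomputable def wedge {k l : ℕ} (a : DiffForm E M k) (b : DiffForm E M l) :
    DiffForm E M (k + l) :=
  fun x ↦ altWedge (a x) (b x)

/-- The exterior derivative: at `x`, read the form in the preferred chart at `x`, take the exterior
derivative in the model space, and pull the result back to the manifold. The convention is
`da(X, Y) = X(a(Y)) - Y(a(X)) - a([X, Y])` for `1`-forms. -/
noncomputable def extD {k : ℕ} (a : DiffForm E M k) : DiffForm E M (k + 1) :=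
  fun x ↦ (extDeriv
    (fun y : E ↦ (a ((extChartAt 𝓘(ℝ, E) x).symm y)).compContinuousLinearMap
      (mfderiv 𝓘(ℝ, E) 𝓘(ℝ, E) (extChartAt 𝓘(ℝ, E) x).symm y))
    (extChartAt 𝓘(ℝ, E) x x)).compContinuousLinearMap
      (mfderiv 𝓘(ℝ, E) 𝓘(ℝ, E) (extChartAt 𝓘(ℝ, E) x) x)

end DiffForm

end Forms

/-! ## Connections -/

section Connections

/-- Linear connections on `M`; `nabla Y x v` is `(∇_v Y)(x)`. -/
abbrev Connection (E : Type*) [NormedAddCommGroup E] [NormedSpace ℝ E]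
    (M : Type*) [TopologicalSpace M] [ChartedSpace E M] [IsManifold 𝓘(ℝ, E) ∞ M] : Type _ :=
  CovariantDerivative 𝓘(ℝ, E) E (TangentSpace 𝓘(ℝ, E) : M → Type _)

variable {E : Type*} [NormedAddCommGroup E] [NormedSpace ℝ E]
  {M : Type*} [TopologicalSpace M] [ChartedSpace E M] [IsManifold 𝓘(ℝ, E) ∞ M]

/-- The vector field `Y` is differentiable at `x`. -/
abbrev VFDiffAt (Y : ∀ x : M, TangentSpace 𝓘(ℝ, E) x) (x : M) : Prop :=
  MDifferentiableAt 𝓘(ℝ, E) (𝓘(ℝ, E).prod 𝓘(ℝ, E)) (fun y ↦ Bundle.TotalSpace.mk' E y (Y y)) x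

/-- The differential form `a` is `∇`-parallel: for all vector fields `Y_1, …, Y_k`, the function
`a(Y_1, …, Y_k)` is differentiable, and its derivative along `v` is
`∑ j, a(Y_1, …, ∇_v Y_j, …, Y_k)`. -/
def DiffForm.IsParallel {k : ℕ} (a : DiffForm E M k)
    (nabla : Connection E M) : Prop :=
  ∀ (x : M) (Y : Fin k → ∀ y : M, TangentSpace 𝓘(ℝ, E) y),
    (∀ j, VFDiffAt (Y j) x) →
    MDifferentiableAt 𝓘(ℝ, E) 𝓘(ℝ, ℝ) (fun y ↦ a y (fun j ↦ Y j y)) x ∧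
    ∀ v : TangentSpace 𝓘(ℝ, E) x,
      mvfderiv 𝓘(ℝ, E) (fun y ↦ a y (fun j ↦ Y j y)) x v =
        ∑ j, a x (Function.update (fun l ↦ Y l x) j (nabla (Y j) x v))

end Connections

/-! ## Almost 3-contact metric manifolds -/

section Contact

variable (E : Type*) [NormedAddCommGroup E] [NormedSpace ℝ E]
  (M : Type*) [TopologicalSpace M] [ChartedSpace E M] [IsManifold 𝓘(ℝ, E) ∞ M]

/-- An almost contact structure `(φ, ξ, η)` on a smooth manifold. -/
structure AlmostContactStructure where
  φ : ∀ x : M, TangentSpace 𝓘(ℝ, E) x →L[ℝ] TangentSpace 𝓘(ℝ, E) x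
  ξ : ∀ x : M, TangentSpace 𝓘(ℝ, E) x
  η : ∀ x : M, TangentSpace 𝓘(ℝ, E) x →L[ℝ] ℝ
  smooth_φ : ContMDiff 𝓘(ℝ, E) (𝓘(ℝ, E).prod 𝓘(ℝ, E →L[ℝ] E)) ∞
    (fun x ↦ Bundle.TotalSpace.mk' (E →L[ℝ] E) x (φ x))
  smooth_ξ : ContMDiff 𝓘(ℝ, E) (𝓘(ℝ, E).prod 𝓘(ℝ, E)) ∞
    (fun x ↦ Bundle.TotalSpace.mk' E x (ξ x))
  smooth_η : ContMDiff 𝓘(ℝ, E) (𝓘(ℝ, E).prod 𝓘(ℝ, E →L[ℝ] ℝ)) ∞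
    (fun x ↦ Bundle.TotalSpace.mk' (E →L[ℝ] ℝ) x (η x))
  φ_φ : ∀ x v, φ x (φ x v) = -v + η x v • ξ x
  η_ξ : ∀ x, η x (ξ x) = 1

/-- An almost 3-contact metric structure `(φ_i, ξ_i, η_i, g)`. The index set `{1, 2, 3}` is
modelled by `Fin 3`, so that the even permutations of `(1, 2, 3)` are the triples
`(i, i + 1, i + 2)`. -/
structure AlmostThreeContactMetricStructure where
  str : Fin 3 → AlmostContactStructure E M
  g : Bundle.ContMDiffRiemannianMetric 𝓘(ℝ, E) ∞ E (fun x : M ↦ TangentSpace 𝓘(ℝ, E) x)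
  φ_eq : ∀ i x v, (str (i + 2)).φ x v =
    (str i).φ x ((str (i + 1)).φ x v) - (str (i + 1)).η x v • (str i).ξ x
  φ_eq' : ∀ i x v, (str (i + 2)).φ x v =
    -(str (i + 1)).φ x ((str i).φ x v) + (str i).η x v • (str (i + 1)).ξ x
  ξ_eq : ∀ i x, (str (i + 2)).ξ x = (str i).φ x ((str (i + 1)).ξ x)
  ξ_eq' : ∀ i x, (str (i + 2)).ξ x = -(str (i + 1)).φ x ((str i).ξ x)
  η_eq : ∀ i x v, (str (i + 2)).η x v = (str i).η x ((str (i + 1)).φ x v)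
  η_eq' : ∀ i x v, (str (i + 2)).η x v = -(str (i + 1)).η x ((str i).φ x v)
  compatible : ∀ i x v w, g.inner x ((str i).φ x v) ((str i).φ x w) =
    g.inner x v w - (str i).η x v * (str i).η x w

namespace AlmostThreeContactMetricStructure

variable {E M}
variable (S : AlmostThreeContactMetricStructure E M)

/-- `φ_i`. -/
abbrev φ (i : Fin 3) (x : M) : TangentSpace 𝓘(ℝ, E) x →L[ℝ] TangentSpace 𝓘(ℝ, E) x :=
  (S.str i).φ x

/-- `ξ_i`. -/
abbrev ξ (i : Fin 3) (x : M) : TangentSpace 𝓘(ℝ, E) x := (S.str i).ξ x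

/-- `η_i`, as a field of linear forms. -/
abbrev η (i : Fin 3) (x : M) : TangentSpace 𝓘(ℝ, E) x →L[ℝ] ℝ := (S.str i).η x

theorem g_φ_self (i : Fin 3) (x : M) (v : TangentSpace 𝓘(ℝ, E) x) :
    S.g.inner x v (S.φ i x v) = 0 := by
  have h1 : S.φ i x (S.φ i x (S.ξ i x)) = 0 := by
    rw [(S.str i).φ_φ, (S.str i).η_ξ]; simp
  have h2 := (S.str i).φ_φ x (S.φ i x (S.ξ i x))
  rw [h1, map_zero] at h2
  have h3 : S.φ i x (S.ξ i x) = S.η i x (S.φ i x (S.ξ i x)) • S.ξ i x := by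
    rw [eq_comm, neg_add_eq_zero] at h2; exact h2
  have h5 : S.φ i x (S.ξ i x) = 0 := by
    have h4 := h1
    rw [h3, map_smul] at h4
    rcases smul_eq_zero.1 h4 with h | h
    · rw [h3, h, zero_smul]
    · exact h
  have h6 (w : TangentSpace 𝓘(ℝ, E) x) : S.g.inner x w (S.ξ i x) = S.η i x w := by
    have := S.compatible i x w (S.ξ i x)
    rw [h5, map_zero, (S.str i).η_ξ] at this
    linarith
  have h7 : S.η i x (S.φ i x v) = 0 := by
    rw [← h6]
    have := S.compatible i x v (S.ξ i x)
    have h8 := (S.str i).φ_φ x (S.φ i x v)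
    rw [(S.str i).φ_φ x v, map_add, map_neg, map_smul, h5, smul_zero, add_zero,
      left_eq_add] at h8
    rw [h6]
    rcases smul_eq_zero.1 h8 with h | h
    · exact h
    · have := (S.str i).η_ξ x
      rw [h, map_zero] at this
      exact absurd this zero_ne_one
  have h9 := S.compatible i x v (S.φ i x v)
  rw [(S.str i).φ_φ x v, map_add, map_neg, map_smul, h6, h7, S.g.symm] at h9
  simp at h9
  linarith

/-- `η_i`, as a differential `1`-form. -/
noncomputable def ηForm (i : Fin 3) : DiffForm E M 1 := DiffForm.ofCovector (S.η i)

/-- The fundamental `2`-form `Φ_i(X, Y) = g(X, φ_i Y)`. -/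
noncomputable def Φ (i : Fin 3) : DiffForm E M 2 := fun x ↦
  { toFun := fun v ↦ S.g.inner x (v 0) (S.φ i x (v 1))
    map_update_add' := by
      intro _ m j v w
      fin_cases j <;> simp
    map_update_smul' := by
      intro _ m j c v
      fin_cases j <;> simp
    cont := by
      have h0 : Continuous fun p : E × E ↦ (S.g.inner x : E →L[ℝ] E →L[ℝ] ℝ) p.1 p.2 :=
        ContinuousLinearMap.continuous₂ _
      have h1 : Continuous fun v : Fin 2 → E ↦ (v 0, (S.φ i x : E →L[ℝ] E) (v 1)) := by fun_prop
      exact h0.comp h1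
    map_eq_zero_of_eq' := by
      intro v j k h hjk
      have : v 0 = v 1 := by
        fin_cases j <;> fin_cases k <;> simp_all
      rw [this]
      exact S.g_φ_self i x (v 1) }

/-- The projection onto the horizontal distribution `⋂ ker η_i` along the vertical distribution
`⟨ξ₁, ξ₂, ξ₃⟩`. -/
noncomputable def hProj (x : M) : TangentSpace 𝓘(ℝ, E) x →L[ℝ] TangentSpace 𝓘(ℝ, E) x :=
  ContinuousLinearMap.id ℝ _ - ∑ i, (S.η i x).smulRight (S.ξ i x)

/-- The horizontal part of the fundamental form `Φ_i`. -/
noncomputable def ΦH (i : Fin 3) : DiffForm E M 2 :=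
  fun x ↦ (S.Φ i x).compContinuousLinearMap (S.hProj x)

/-- The `2`-form `η_{jk} = η_j ∧ η_k`. -/
noncomputable def η₂ (j k : Fin 3) : DiffForm E M 2 := (S.ηForm j).wedge (S.ηForm k)

/-- The `3`-form `η_{123} = η_1 ∧ η_2 ∧ η_3`. -/
noncomputable def η₁₂₃ : DiffForm E M 3 := (S.ηForm 0).wedge (S.η₂ 1 2)

/-- `3`-`(α, δ)`-Sasaki manifolds. -/
structure IsThreeSasaki (α δ : ℝ) : Prop where
  α_ne_zero : α ≠ 0
  d_η : ∀ i, (S.ηForm i).extD =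
    (2 * α) • S.Φ i + (2 * (α - δ)) • S.η₂ (i + 1) (i + 2)

variable [FiniteDimensional ℝ E]

/-- `∇` is a metric connection: `v(g(Y, Z)) = g(∇_v Y, Z) + g(Y, ∇_v Z)`. -/
def IsMetricConnection (nabla : Connection E M) : Prop :=
  ∀ (x : M) (Y Z : ∀ y : M, TangentSpace 𝓘(ℝ, E) y), VFDiffAt Y x → VFDiffAt Z x →
    ∀ v : TangentSpace 𝓘(ℝ, E) x,
      mvfderiv 𝓘(ℝ, E) (fun y ↦ S.g.inner y (Y y) (Z y)) x v =
        S.g.inner x (nabla Y x v) (Z x) + S.g.inner x (Y x) (nabla Z x v)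

/-- The `3`-form `T` is the torsion of `∇`, i.e. `T(X, Y, Z) = g(T(X, Y), Z)` where `T(X, Y)` is
the torsion tensor of `∇`. -/
def IsTorsionForm (nabla : Connection E M) (T : DiffForm E M 3) : Prop :=
  ∀ (x : M) (u v w : TangentSpace 𝓘(ℝ, E) x),
    T x ![u, v, w] = S.g.inner x (nabla.torsion x u v) w

/-- `∇` has totally skew-symmetric torsion. -/
def HasSkewTorsion (nabla : Connection E M) : Prop :=
  ∃ T : DiffForm E M 3, S.IsTorsionForm nabla T

/-- Canonical connections: smooth metric connections with skew torsion such that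
`∇_v φ_i = β (η_k(v) φ_j - η_j(v) φ_k)` for a smooth function `β` and all even permutations
`(i, j, k)` of `(1, 2, 3)`. The left hand side is evaluated on vector fields through
`(∇_v φ_i) Y = ∇_v (φ_i Y) - φ_i (∇_v Y)`. -/
structure IsCanonicalConnection (nabla : Connection E M) : Prop where
  smooth : nabla.ContMDiffCovariantDerivative ∞
  metric : S.IsMetricConnection nabla
  skew : S.HasSkewTorsion nabla
  nabla_φ : ∃ β : M → ℝ, ContMDiff 𝓘(ℝ, E) 𝓘(ℝ, ℝ) ∞ β ∧
    ∀ (i : Fin 3) (x : M) (Y : ∀ y : M, TangentSpace 𝓘(ℝ, E) y), VFDiffAt Y x →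
      ∀ v : TangentSpace 𝓘(ℝ, E) x,
        nabla (fun y ↦ S.φ i y (Y y)) x v - S.φ i x (nabla Y x v) =
          β x • (S.η (i + 2) x v • S.φ (i + 1) x (Y x) - S.η (i + 1) x v • S.φ (i + 2) x (Y x))

end AlmostThreeContactMetricStructure

end Contact

/-! Existence. The Koszul formula yields a unique metric connection ∇ with any prescribed skew
torsion, so the point is that the connection with the stated T rotates the φ_i. At each point (∇_u
φ_i, ∇_u ξ_i) is a first variation of an almost 3-contact metric structure with fixed metric
(`IsMetricConnection.isVariation`). The equation for dη_i determines the skew part of ∇ξ_i, and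
d(dη_i) = 0, after division by α, determines the cyclic sum of g((∇_u φ_i)v, w). Both agree with
those of the infinitesimal rotation with angular velocity β η_r(u), β = 2(δ - 2α). What is left
after subtracting this rotation is a variation with symmetric ∇ξ_i part and zero cyclic sums. On V ×
ℝ, the tangent space of the cone, it becomes a variation of an almost hyperhermitian structure whose
three cyclic sums vanish. An algebraic version of Hitchin's lemma (closed fundamental forms make the
structure hyperkähler) shows that it is zero: `eq_zero_of_cyclic_sums_eq_zero`, `variation_eq_zero`,
`IsSasakiJet.eq_rot`.

Parallel torsion and dT. T is a combination of ∑ η_i ∧ Φ_i and η_123, both invariant under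
simultaneous rotation of the triple, hence ∇T = 0. For parallel torsion, dT is a quadratic
expression in T, which is evaluated on a single tangent space (`sum_torsion_torsion`).

Uniqueness. Two canonical connections differ by a tensor D with g(D_u v, w) totally skew and with
commutators [D_u, φ_i] a rotation of coefficient c = β' - β. Then D_u ξ_i is vertical with
coefficients c η_r(u), so D_y ξ_i = 0 for horizontal y and, by skewness, D_{ξ_i} y = 0. Comparing
with the commutator gives c φ y = 0, so c = 0 as soon as a horizontal y ≠ 0 exists, that is for n ≥
1. A totally skew D commuting with the φ_i vanishes (`difference_eq_zero`). -/

section Wedge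

/-! ### Exterior products in low degree as explicit sums. -/

variable {V : Type*} [AddCommGroup V] [Module ℝ V] [TopologicalSpace V]

-- Each shuffle class consists of k! l! permutations with equal summands. Clearing this factor
-- replaces the sum over a quotient by one over the full symmetric group, which can be enumerated in
-- low degree.
open Equiv in
theorem factorial_smul_altWedge {k l : ℕ} (a : V [⋀^Fin k]→L[ℝ] ℝ) (b : V [⋀^Fin l]→L[ℝ] ℝ)
    (v : Fin (k + l) → V) :
    ((k.factorial * l.factorial : ℕ) : ℝ) * altWedge a b v =
      ∑ σ : Perm (Fin (k + l)), ((Perm.sign σ : ℤ) : ℝ) *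
        (a (fun i ↦ v (σ (Fin.castAdd l i))) * b (fun i ↦ v (σ (Fin.natAdd k i)))) := by
  have h := MultilinearMap.domCoprod_alternization_eq a.toAlternatingMap b.toAlternatingMap
  have h' := congrArg (fun f ↦ LinearMap.mul' ℝ ℝ (f (fun i ↦ v (finSumFinEquiv i)))) h
  simp only [Fintype.card_fin] at h'
  have h1 : altWedge a b v = LinearMap.mul' ℝ ℝ ((a.toAlternatingMap.domCoprod b.toAlternatingMap)
    (fun i ↦ v (finSumFinEquiv i))) := rfl
  rw [h1, ← nsmul_eq_mul, ← map_nsmul]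
  refine h'.symm.trans ?_
  rw [MultilinearMap.alternatization_apply, map_sum]
  refine Fintype.sum_equiv (finSumFinEquiv.permCongr) _ _ fun σ ↦ ?_
  rw [Units.smul_def, map_zsmul, Perm.sign_permCongr, zsmul_eq_mul]
  congr 1
  simp [MultilinearMap.domDomCongr_apply, MultilinearMap.domCoprod_apply]

theorem Finset.sum_perm_fin_succ {n : ℕ} (f : Equiv.Perm (Fin (n + 1)) → ℝ) :
    ∑ σ, f σ = ∑ p, ∑ τ, f (Equiv.Perm.decomposeFin.symm (p, τ)) := by
  rw [Finset.univ_perm_fin_succ, Finset.sum_map, Finset.univ_product_univ.symm, Finset.sum_product]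
  rfl

theorem altWedge_one_one (a b : V [⋀^Fin 1]→L[ℝ] ℝ) (v : Fin 2 → V) :
    altWedge a b v = a ![v 0] * b ![v 1] - a ![v 1] * b ![v 0] := by
  have h := factorial_smul_altWedge a b v
  have e (f : Fin 1 → V) : f = ![f 0] := by ext x; fin_cases x; rfl
  simp_rw [e (fun _ ↦ v _)] at h
  simp [Finset.sum_perm_fin_succ, Fin.sum_univ_succ] at h
  linarith

theorem ContinuousAlternatingMap.swap_two (b : V [⋀^Fin 2]→L[ℝ] ℝ) (u v : V) :
    b ![v, u] = -b ![u, v] := by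
  have h := b.toAlternatingMap.map_swap ![u, v] (i := 0) (j := 1) (by decide)
  rwa [show ![u, v] ∘ Equiv.swap 0 1 = ![v, u] by ext i; fin_cases i <;> rfl] at h

theorem altWedge_one_two (a : V [⋀^Fin 1]→L[ℝ] ℝ) (b : V [⋀^Fin 2]→L[ℝ] ℝ) (v : Fin 3 → V) :
    altWedge a b v = a ![v 0] * b ![v 1, v 2] - a ![v 1] * b ![v 0, v 2]
      + a ![v 2] * b ![v 0, v 1] := by
  have h := factorial_smul_altWedge a b v
  have e (f : Fin 1 → V) : f = ![f 0] := by ext x; fin_cases x; rfl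
  have e' (f : Fin 2 → V) : f = ![f 0, f 1] := by ext x; fin_cases x <;> rfl
  simp_rw [e (fun _ : Fin 1 ↦ v _), e' (fun _ ↦ v _)] at h
  have d2 (p : Fin 3) (τ : Equiv.Perm (Fin 2)) :
      Equiv.Perm.decomposeFin.symm (p, τ) 2 = Equiv.swap 0 p (τ 1).succ :=
    Equiv.Perm.decomposeFin_symm_apply_succ τ p 1
  simp [Finset.sum_perm_fin_succ, Fin.sum_univ_succ, d2, Equiv.swap_apply_def] at h
  simp only [b.swap_two (v 1) (v 2), b.swap_two (v 0) (v 2), b.swap_two (v 0) (v 1)] at h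
  linarith

theorem altWedge_two_two (a b : V [⋀^Fin 2]→L[ℝ] ℝ) (v : Fin 4 → V) :
    altWedge a b v = a ![v 0, v 1] * b ![v 2, v 3] - a ![v 0, v 2] * b ![v 1, v 3]
      + a ![v 0, v 3] * b ![v 1, v 2] + a ![v 1, v 2] * b ![v 0, v 3]
      - a ![v 1, v 3] * b ![v 0, v 2] + a ![v 2, v 3] * b ![v 0, v 1] := by
  have h := factorial_smul_altWedge a b v
  have e (f : Fin 2 → V) : f = ![f 0, f 1] := by ext x; fin_cases x <;> rfl
  simp_rw [e (fun _ ↦ v _)] at h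
  have c2 (p : Fin 3) (τ : Equiv.Perm (Fin 2)) :
      Equiv.Perm.decomposeFin.symm (p, τ) 2 = Equiv.swap 0 p (τ 1).succ :=
    Equiv.Perm.decomposeFin_symm_apply_succ τ p 1
  have d2 (p : Fin 4) (τ : Equiv.Perm (Fin 3)) :
      Equiv.Perm.decomposeFin.symm (p, τ) 2 = Equiv.swap 0 p (τ 1).succ :=
    Equiv.Perm.decomposeFin_symm_apply_succ τ p 1
  have d3 (p : Fin 4) (τ : Equiv.Perm (Fin 3)) :
      Equiv.Perm.decomposeFin.symm (p, τ) 3 = Equiv.swap 0 p (τ 2).succ :=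
    Equiv.Perm.decomposeFin_symm_apply_succ τ p 2
  simp [Finset.sum_perm_fin_succ, Fin.sum_univ_succ, c2, d2, d3, Equiv.swap_apply_def] at h
  have s (c : V [⋀^Fin 2]→L[ℝ] ℝ) := And.intro (c.swap_two (v 0) (v 1)) <|
    And.intro (c.swap_two (v 0) (v 2)) <| And.intro (c.swap_two (v 0) (v 3)) <|
    And.intro (c.swap_two (v 1) (v 2)) <| And.intro (c.swap_two (v 1) (v 3))
    (c.swap_two (v 2) (v 3))
  obtain ⟨a1, a2, a3, a4, a5, a6⟩ := s a
  obtain ⟨b1, b2, b3, b4, b5, b6⟩ := s b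
  simp only [a1, a2, a3, a4, a5, a6, b1, b2, b3, b4, b5, b6] at h
  linarith

end Wedge

/-! ## Linear algebra of almost 3-contact metric structures -/

/-- A trilinear expression attached to an infinitesimal deformation of an almost hyperhermitian
structure vanishes as soon as its three cyclic sums do. -/
theorem eq_zero_of_cyclic_sums_eq_zero {W : Type*} [AddCommGroup W]
    (I₁ I₂ I₃ : W → W) (b₁ b₂ b₃ : W → W → W → ℝ)
    (hI : ∀ x, I₁ (I₁ x) = -x) (hI₂₁ : ∀ x, I₂ (I₁ x) = -I₃ x) (hI₁₂ : ∀ x, I₁ (I₂ x) = I₃ x)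
    (hI₃ : ∀ x, I₃ (I₃ x) = -x)
    (neg₁ : ∀ x y z, b₁ x y (-z) = -b₁ x y z) (neg₁' : ∀ x y z, b₁ (-x) y z = -b₁ x y z)
    (skew₁ : ∀ x y z, b₁ x y z = -b₁ x z y) (skew₂ : ∀ x y z, b₂ x y z = -b₂ x z y)
    (skew₃ : ∀ x y z, b₃ x y z = -b₃ x z y)
    (comm : ∀ x y z, b₁ x (I₁ y) z = b₁ x y (I₁ z))
    (h₂ : ∀ x y z, b₂ x (I₁ y) z = b₁ x y (I₂ z) - b₃ x y z)
    (h₃ : ∀ x y z, b₃ x (I₁ y) z = b₂ x y z + b₁ x y (I₃ z))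
    (cyc₁ : ∀ x y z, b₁ x y z + b₁ y z x + b₁ z x y = 0)
    (cyc₂ : ∀ x y z, b₂ x y z + b₂ y z x + b₂ z x y = 0)
    (cyc₃ : ∀ x y z, b₃ x y z + b₃ y z x + b₃ z x y = 0) (x y z : W) :
    b₁ x y z = 0 := by
  have comm' (x y z) : b₁ x (I₁ y) (I₁ z) = -b₁ x y z := by rw [comm, hI, neg₁]
  -- The algebraic form of "almost Kähler implies quasi-Kähler": four cyclic sums whose arguments
  -- are moved by `I₁`.
  have shift' (x y z) : b₁ (I₁ x) (I₁ y) z = -b₁ x y z := by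
    have e1 := cyc₁ x y z
    have e2 := cyc₁ x (I₁ y) (I₁ z)
    have e3 := cyc₁ (I₁ x) (I₁ y) z
    have e4 := cyc₁ (I₁ x) y (I₁ z)
    rw [comm'] at e2
    have := comm' y z x
    have := comm' z x y
    have := comm (I₁ y) z x
    have := comm (I₁ z) x y
    have := comm (I₁ x) y z
    linarith
  have shift (x y z) : b₁ (I₁ x) y z = b₁ x (I₁ y) z := by
    have h := shift' (I₁ x) y z
    rw [hI, neg₁'] at h
    linarith
  -- The other two structures enter here: `h₂` and `h₃` turn the cyclic sums of `b₂` and `b₃` into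
  -- relations in which everything but `b₁` cancels.
  have symm (x y z) : b₁ x y (I₃ z) = b₁ y x (I₃ z) := by
    have e1 := cyc₂ x y z
    have e2 := cyc₂ (I₁ x) (I₁ y) z
    have e3 := cyc₃ (I₁ x) y z
    have e4 := cyc₃ x (I₁ y) z
    rw [h₂ (I₁ x) y z, skew₂ (I₁ y) z (I₁ x), h₂ (I₁ y) x z, h₂ z x (I₁ y), hI₂₁, neg₁, shift,
      shift, comm, comm, hI₁₂] at e2
    rw [skew₃ y z (I₁ x), h₃ y x z, h₃ z x y] at e3
    rw [h₃ x y z, skew₃ (I₁ y) z x] at e4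
    have := skew₂ y z x
    linarith
  have symm' (x y z) : b₁ x y z = b₁ y x z := by
    have := symm x y (I₃ z)
    rw [hI₃, neg₁, neg₁] at this
    linarith
  -- Skew in the last two slots and symmetric in the first two: alternating the two transpositions
  -- six times returns to the start with the opposite sign.
  have := skew₁ x y z
  have := symm' x z y
  have := skew₁ z x y
  have := symm' z y x
  have := skew₁ y z x
  have := symm' x y z
  linarith

/-- An almost 3-contact metric structure on a vector space; the linear forms `η_i` are
`g(ξ_i, ·)`. -/
structure ThreeContactSpace (V : Type*) [AddCommGroup V] [Module ℝ V] where
  g : V →ₗ[ℝ] V →ₗ[ℝ] ℝ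
  φ : Fin 3 → V →ₗ[ℝ] V
  ξ : Fin 3 → V
  g_symm : ∀ v w, g v w = g w v
  nondeg : ∀ v, (∀ w, g v w = 0) → v = 0
  φ_skew : ∀ i v w, g (φ i v) w = -g v (φ i w)
  g_ξ : ∀ i j, g (ξ i) (ξ j) = if i = j then 1 else 0
  φ_φ_self : ∀ i v, φ i (φ i v) = -v + g (ξ i) v • ξ i
  φ_φ_succ : ∀ i v, φ i (φ (i + 1) v) = φ (i + 2) v + g (ξ (i + 1)) v • ξ i
  φ_succ_φ : ∀ i v, φ (i + 1) (φ i v) = -φ (i + 2) v + g (ξ i) v • ξ (i + 1)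
  φ_ξ_self : ∀ i, φ i (ξ i) = 0
  φ_ξ_succ : ∀ i, φ i (ξ (i + 1)) = ξ (i + 2)
  φ_succ_ξ : ∀ i, φ (i + 1) (ξ i) = -ξ (i + 2)

@[simp] theorem Fin.three_add_one_add_one (i : Fin 3) : i + 1 + 1 = i + 2 := by revert i; decide
@[simp] theorem Fin.three_add_one_add_two (i : Fin 3) : i + 1 + 2 = i := by revert i; decide
@[simp] theorem Fin.three_add_two_add_one (i : Fin 3) : i + 2 + 1 = i := by revert i; decide
@[simp] theorem Fin.three_add_two_add_two (i : Fin 3) : i + 2 + 2 = i + 1 := by revert i; decide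

theorem Fin.sum_three_cyclic {A : Type*} [AddCommMonoid A] (f : Fin 3 → A) (i : Fin 3) :
    ∑ r, f r = f i + f (i + 1) + f (i + 2) := by
  rw [Fin.sum_univ_three]
  fin_cases i
  · rfl
  · exact (add_comm _ _).trans ((add_comm _ _).trans (add_rotate (f 0) (f 1) (f 2)))
  · exact ((add_rotate (f 2) (f 0) (f 1))).symm

namespace ThreeContactSpace

open Fin

variable {V : Type*} [AddCommGroup V] [Module ℝ V] (L : ThreeContactSpace V)

attribute [simp] φ_φ_self φ_φ_succ φ_succ_φ φ_ξ_self φ_ξ_succ φ_succ_ξ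

@[simp] theorem φ_succ_φ_two (i v) :
    L.φ (i + 1) (L.φ (i + 2) v) = L.φ i v + L.g (L.ξ (i + 2)) v • L.ξ (i + 1) := by
  simpa only [three_add_one_add_one, three_add_one_add_two] using L.φ_φ_succ (i + 1) v

@[simp] theorem φ_two_φ_succ (i v) :
    L.φ (i + 2) (L.φ (i + 1) v) = -L.φ i v + L.g (L.ξ (i + 1)) v • L.ξ (i + 2) := by
  simpa only [three_add_one_add_one, three_add_one_add_two] using L.φ_succ_φ (i + 1) v

@[simp] theorem φ_two_φ (i v) :
    L.φ (i + 2) (L.φ i v) = L.φ (i + 1) v + L.g (L.ξ i) v • L.ξ (i + 2) := by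
  simpa only [three_add_two_add_one, three_add_two_add_two] using L.φ_φ_succ (i + 2) v

@[simp] theorem φ_φ_two (i v) :
    L.φ i (L.φ (i + 2) v) = -L.φ (i + 1) v + L.g (L.ξ (i + 2)) v • L.ξ i := by
  simpa only [three_add_two_add_one, three_add_two_add_two] using L.φ_succ_φ (i + 2) v

@[simp] theorem φ_succ_ξ_two (i) : L.φ (i + 1) (L.ξ (i + 2)) = L.ξ i := by
  simpa only [three_add_one_add_one, three_add_one_add_two] using L.φ_ξ_succ (i + 1)

@[simp] theorem φ_two_ξ_succ (i) : L.φ (i + 2) (L.ξ (i + 1)) = -L.ξ i := by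
  simpa only [three_add_one_add_one, three_add_one_add_two] using L.φ_succ_ξ (i + 1)

@[simp] theorem φ_two_ξ (i) : L.φ (i + 2) (L.ξ i) = L.ξ (i + 1) := by
  simpa only [three_add_two_add_one, three_add_two_add_two] using L.φ_ξ_succ (i + 2)

@[simp] theorem φ_ξ_two (i) : L.φ i (L.ξ (i + 2)) = -L.ξ (i + 1) := by
  simpa only [three_add_two_add_one, three_add_two_add_two] using L.φ_succ_ξ (i + 2)

theorem g_ξ_φ (i j v) : L.g (L.ξ i) (L.φ j v) = -L.g (L.φ j (L.ξ i)) v := by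
  rw [L.φ_skew, neg_neg]

/-- The first variation of the defining identities of an almost 3-contact metric structure with
fixed metric: `B_i` is the variation of `φ_i` and `C_i` that of `ξ_i`. -/
structure IsVariation (B : Fin 3 → V →ₗ[ℝ] V) (C : Fin 3 → V) : Prop where
  skew : ∀ i v w, L.g (B i v) w = -L.g v (B i w)
  g_ξ : ∀ i j, L.g (C i) (L.ξ j) + L.g (C j) (L.ξ i) = 0
  φ_φ_self : ∀ i v, B i (L.φ i v) + L.φ i (B i v) = L.g (C i) v • L.ξ i + L.g (L.ξ i) v • C i
  φ_φ_succ : ∀ i v, B i (L.φ (i + 1) v) + L.φ i (B (i + 1) v) =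
    B (i + 2) v + L.g (C (i + 1)) v • L.ξ i + L.g (L.ξ (i + 1)) v • C i
  φ_succ_φ : ∀ i v, B (i + 1) (L.φ i v) + L.φ (i + 1) (B i v) =
    -B (i + 2) v + L.g (C i) v • L.ξ (i + 1) + L.g (L.ξ i) v • C (i + 1)
  φ_ξ_self : ∀ i, B i (L.ξ i) + L.φ i (C i) = 0
  φ_ξ_succ : ∀ i, B i (L.ξ (i + 1)) + L.φ i (C (i + 1)) = C (i + 2)
  φ_succ_ξ : ∀ i, B (i + 1) (L.ξ i) + L.φ (i + 1) (C i) = -C (i + 2)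

variable {L}

theorem IsVariation.sub {B B' : Fin 3 → V →ₗ[ℝ] V} {C C' : Fin 3 → V} (h : L.IsVariation B C)
    (h' : L.IsVariation B' C') : L.IsVariation (B - B') (C - C') where
  skew i v w := by simp [h.skew i v w, h'.skew i v w]; ring
  g_ξ i j := by
    simp only [Pi.sub_apply, LinearMap.sub_apply, map_sub]
    linear_combination h.g_ξ i j - h'.g_ξ i j
  φ_φ_self i v := by
    simp only [Pi.sub_apply, LinearMap.sub_apply, map_sub, sub_smul, smul_sub]
    linear_combination (norm := module) h.φ_φ_self i v - h'.φ_φ_self i v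
  φ_φ_succ i v := by
    simp only [Pi.sub_apply, LinearMap.sub_apply, map_sub, sub_smul, smul_sub]
    linear_combination (norm := module) h.φ_φ_succ i v - h'.φ_φ_succ i v
  φ_succ_φ i v := by
    simp only [Pi.sub_apply, LinearMap.sub_apply, map_sub, sub_smul, smul_sub]
    linear_combination (norm := module) h.φ_succ_φ i v - h'.φ_succ_φ i v
  φ_ξ_self i := by
    simp only [Pi.sub_apply, LinearMap.sub_apply, map_sub]
    linear_combination (norm := module) h.φ_ξ_self i - h'.φ_ξ_self i
  φ_ξ_succ i := by
    simp only [Pi.sub_apply, LinearMap.sub_apply, map_sub]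
    linear_combination (norm := module) h.φ_ξ_succ i - h'.φ_ξ_succ i
  φ_succ_ξ i := by
    simp only [Pi.sub_apply, LinearMap.sub_apply, map_sub]
    linear_combination (norm := module) h.φ_succ_ξ i - h'.φ_succ_ξ i

variable (L)

/-- The infinitesimal rotation of `(φ_1, φ_2, φ_3)` with angular velocity `a`. -/
def rotφ (a : Fin 3 → ℝ) (i : Fin 3) : V →ₗ[ℝ] V :=
  a (i + 2) • L.φ (i + 1) - a (i + 1) • L.φ (i + 2)

/-- The infinitesimal rotation of `(ξ_1, ξ_2, ξ_3)` with angular velocity `a`. -/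
def rotξ (a : Fin 3 → ℝ) (i : Fin 3) : V := a (i + 2) • L.ξ (i + 1) - a (i + 1) • L.ξ (i + 2)

/-- The defining identities are preserved when an element of SO(3) acts on the triples (φ_i) and
(ξ_i); this is the derivative of that action. -/
theorem isVariation_rot (a : Fin 3 → ℝ) : L.IsVariation (L.rotφ a) (L.rotξ a) where
  skew i v w := by simp [rotφ, L.φ_skew]; ring
  g_ξ i j := by
    simp only [rotξ, map_sub, map_smul, LinearMap.sub_apply, LinearMap.smul_apply, L.g_ξ]
    fin_cases i <;> fin_cases j <;> simp
  φ_φ_self i v := by simp [rotφ, rotξ]; module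
  φ_φ_succ i v := by simp [rotφ, rotξ]; module
  φ_succ_φ i v := by simp [rotφ, rotξ]; module
  φ_ξ_self i := by simp [rotφ, rotξ]
  φ_ξ_succ i := by simp [rotφ, rotξ]; module
  φ_succ_ξ i := by simp [rotφ, rotξ]; module

/-- The trilinear form on `V × ℝ` attached to a family of variations. -/
def coneForm (B : V →ₗ[ℝ] V →ₗ[ℝ] V) (C : V →ₗ[ℝ] V) (x y z : V × ℝ) : ℝ :=
  L.g (B x.1 y.1) z.1 - y.2 * L.g (C x.1) z.1 + z.2 * L.g (C x.1) y.1

/-- The almost complex structure on `V × ℝ` attached to `φ_i`. -/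
def coneJ (i : Fin 3) (x : V × ℝ) : V × ℝ := (L.φ i x.1 - x.2 • L.ξ i, L.g (L.ξ i) x.1)

theorem coneJ_coneJ (i x) : L.coneJ i (L.coneJ i x) = -x := by
  ext <;> simp [coneJ, L.g_ξ_φ, L.g_ξ]

theorem coneJ_coneJ_succ (i x) : L.coneJ i (L.coneJ (i + 1) x) = L.coneJ (i + 2) x := by
  ext <;> simp [coneJ, L.g_ξ_φ, L.g_ξ]
  module

theorem coneJ_succ_coneJ (i x) : L.coneJ (i + 1) (L.coneJ i x) = -L.coneJ (i + 2) x := by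
  ext <;> simp [coneJ, L.g_ξ_φ, L.g_ξ]
  module

/-- `coneForm` pairs the variation (v, s) ↦ (B v - s C, g(C, v)) of `coneJ` with the product metric.
The linearised 3-contact identities become the linearised quaternion relations on V × ℝ, and the
hypotheses on `C` and `B` together say that the cyclic sums vanish there, so the hyperhermitian
lemma applies. -/
theorem variation_eq_zero (B : Fin 3 → V →ₗ[ℝ] V →ₗ[ℝ] V) (C : Fin 3 → V →ₗ[ℝ] V)
    (h : ∀ u, L.IsVariation (B · u) (C · u)) (hC : ∀ i u v, L.g (C i u) v = L.g (C i v) u)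
    (hB : ∀ i u v w, L.g (B i u v) w + L.g (B i v w) u + L.g (B i w u) v = 0) (i : Fin 3) :
    B i = 0 ∧ C i = 0 := by
  have key (x y z : V × ℝ) : L.coneForm (B i) (C i) x y z = 0 := by
    have skew (j : Fin 3) (x y z) :
        L.coneForm (B j) (C j) x y z = -L.coneForm (B j) (C j) x z y := by
      simp only [coneForm, (h x.1).skew j y.1 z.1, L.g_symm y.1]
      ring
    have cyc (j : Fin 3) (x y z) : L.coneForm (B j) (C j) x y z + L.coneForm (B j) (C j) y z x
        + L.coneForm (B j) (C j) z x y = 0 := by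
      simp only [coneForm]
      linear_combination hB j x.1 y.1 z.1 + x.2 * hC j y.1 z.1 + y.2 * hC j z.1 x.1
        + z.2 * hC j x.1 y.1
    refine eq_zero_of_cyclic_sums_eq_zero (L.coneJ i) (L.coneJ (i + 1)) (L.coneJ (i + 2))
      (L.coneForm (B i) (C i)) (L.coneForm (B (i + 1)) (C (i + 1)))
      (L.coneForm (B (i + 2)) (C (i + 2))) (L.coneJ_coneJ i) (L.coneJ_succ_coneJ i)
      (L.coneJ_coneJ_succ i) (L.coneJ_coneJ _) ?_ ?_ (skew _) (skew _) (skew _) ?_ ?_ ?_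
      (cyc _) (cyc _) (cyc _) x y z
    · intro x y z; simp [coneForm]; ring
    · intro x y z; simp [coneForm]; ring
    -- The remaining three goals linearise J_i² = -1, J_{i+1} J_i = -J_{i+2} and J_{i+2} J_i =
    -- J_{i+1}.
    · intro x y z
      have hx := h x.1
      have e1 := congrArg (L.g · z.1) (hx.φ_φ_self i y.1)
      have e2 := congrArg (L.g · z.1) (hx.φ_ξ_self i)
      have e3 := congrArg (L.g · y.1) (hx.φ_ξ_self i)
      have e4 := hx.g_ξ i i
      simp [coneForm, coneJ, L.φ_skew, hx.skew i (L.ξ i), L.g_symm (L.ξ i) (B i x.1 _)]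
        at e1 e2 e3 e4 ⊢
      linear_combination e1 - y.2 * e2 - z.2 * e3 - 2 * y.2 * z.2 * e4
    · intro x y z
      have hx := h x.1
      have e1 := congrArg (L.g · z.1) (hx.φ_succ_φ i y.1)
      have e2 := congrArg (L.g · z.1) (hx.φ_succ_ξ i)
      have e3 := congrArg (L.g · y.1) (hx.φ_ξ_succ i)
      have e4 := hx.g_ξ i (i + 1)
      simp [coneForm, coneJ, L.φ_skew, hx.skew i (L.ξ (i + 1)),
        L.g_symm (L.ξ (i + 1)) (B i x.1 _)] at e1 e2 e3 e4 ⊢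
      linear_combination e1 - y.2 * e2 - z.2 * e3 - y.2 * z.2 * e4
    · intro x y z
      have hx := h x.1
      have e1 := congrArg (L.g · z.1) (hx.φ_φ_succ (i + 2) y.1)
      have e2 := congrArg (L.g · z.1) (hx.φ_ξ_succ (i + 2))
      have e3 := congrArg (L.g · y.1) (hx.φ_succ_ξ (i + 2))
      have e4 := hx.g_ξ i (i + 2)
      simp [coneForm, coneJ, L.φ_skew, hx.skew i (L.ξ (i + 2)),
        L.g_symm (L.ξ (i + 2)) (B i x.1 _)] at e1 e2 e3 e4 ⊢
      linear_combination e1 - y.2 * e2 - z.2 * e3 - y.2 * z.2 * e4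
  constructor
  · ext u v
    exact L.nondeg _ fun w ↦ by simpa [coneForm] using key (u, 0) (v, 0) (w, 0)
  · ext u
    -- In the radial direction (0, 1) the form reduces to -g(C u, w).
    exact L.nondeg _ fun w ↦ by simpa [coneForm] using key (u, 0) (0, 1) (w, 0)

end ThreeContactSpace

/-! ### The torsion form on one tangent space: rotation of the structure, rigidity, and the
quadratic expression for dT. -/

namespace ThreeContactSpace

variable {V : Type*} [AddCommGroup V] [Module ℝ V] (L : ThreeContactSpace V)

/-- `η_{123}`. -/
def vol (u v w : V) : ℝ :=
  L.g (L.ξ 0) u * (L.g (L.ξ 1) v * L.g (L.ξ 2) w - L.g (L.ξ 1) w * L.g (L.ξ 2) v)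
    - L.g (L.ξ 0) v * (L.g (L.ξ 1) u * L.g (L.ξ 2) w - L.g (L.ξ 1) w * L.g (L.ξ 2) u)
    + L.g (L.ξ 0) w * (L.g (L.ξ 1) u * L.g (L.ξ 2) v - L.g (L.ξ 1) v * L.g (L.ξ 2) u)

theorem vol_eq (i : Fin 3) (u v w : V) : L.vol u v w =
    L.g (L.ξ i) u * (L.g (L.ξ (i + 1)) v * L.g (L.ξ (i + 2)) w
      - L.g (L.ξ (i + 1)) w * L.g (L.ξ (i + 2)) v)
    - L.g (L.ξ i) v * (L.g (L.ξ (i + 1)) u * L.g (L.ξ (i + 2)) w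
      - L.g (L.ξ (i + 1)) w * L.g (L.ξ (i + 2)) u)
    + L.g (L.ξ i) w * (L.g (L.ξ (i + 1)) u * L.g (L.ξ (i + 2)) v
      - L.g (L.ξ (i + 1)) v * L.g (L.ξ (i + 2)) u) := by
  fin_cases i
  · rfl
  · change _ = L.g (L.ξ 1) u * (L.g (L.ξ 2) v * L.g (L.ξ 0) w - L.g (L.ξ 2) w * L.g (L.ξ 0) v)
      - L.g (L.ξ 1) v * (L.g (L.ξ 2) u * L.g (L.ξ 0) w - L.g (L.ξ 2) w * L.g (L.ξ 0) u)
      + L.g (L.ξ 1) w * (L.g (L.ξ 2) u * L.g (L.ξ 0) v - L.g (L.ξ 2) v * L.g (L.ξ 0) u)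
    rw [vol]; ring
  · change _ = L.g (L.ξ 2) u * (L.g (L.ξ 0) v * L.g (L.ξ 1) w - L.g (L.ξ 0) w * L.g (L.ξ 1) v)
      - L.g (L.ξ 2) v * (L.g (L.ξ 0) u * L.g (L.ξ 1) w - L.g (L.ξ 0) w * L.g (L.ξ 1) u)
      + L.g (L.ξ 2) w * (L.g (L.ξ 0) u * L.g (L.ξ 1) v - L.g (L.ξ 0) v * L.g (L.ξ 1) u)
    rw [vol]; ring

/-- The torsion `3`-form of the canonical connection. -/
def torsion (α δ : ℝ) (u v w : V) : ℝ :=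
  2 * α * ∑ r, (L.g (L.ξ r) u * L.g v (L.φ r w) - L.g (L.ξ r) v * L.g u (L.φ r w)
    + L.g (L.ξ r) w * L.g u (L.φ r v)) + 2 * (δ - α) * L.vol u v w

theorem g_φ_left (i : Fin 3) (v w : V) : L.g v (L.φ i w) = -L.g w (L.φ i v) := by
  rw [L.g_symm v, L.φ_skew]

/-- The volume term contributes 2(δ - α), and each of the two products η_r ∧ Φ_r with r ≠ i
contributes -2α because φ_r ξ_i is again a Reeb vector; the total is 2(δ - 3α). -/
theorem torsion_ξ (α δ : ℝ) (i : Fin 3) (u v : V) : L.torsion α δ u v (L.ξ i) =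
    2 * α * L.g u (L.φ i v) + 2 * (δ - 3 * α) * (L.g (L.ξ (i + 1)) u * L.g (L.ξ (i + 2)) v
      - L.g (L.ξ (i + 1)) v * L.g (L.ξ (i + 2)) u) := by
  have e1 : L.g (L.ξ (i + 1)) (L.ξ i) = 0 := by simp [L.g_ξ]
  have e2 : L.g (L.ξ (i + 2)) (L.ξ i) = 0 := by simp [L.g_ξ]
  have e3 : L.g (L.ξ i) (L.ξ i) = 1 := by simp [L.g_ξ]
  rw [torsion, L.vol_eq i, Fin.sum_three_cyclic _ i, e1, e2, e3]
  simp [L.g_symm u (L.ξ _), L.g_symm v (L.ξ _)]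
  ring

theorem torsion_φ (α δ : ℝ) (i : Fin 3) (x y z : V) : L.torsion α δ x y (L.φ i z) = 2 * α * (
      L.g (L.ξ i) x * (-L.g y z + L.g (L.ξ i) z * L.g (L.ξ i) y)
      + L.g (L.ξ (i + 1)) x * (-L.g y (L.φ (i + 2) z) + L.g (L.ξ i) z * L.g (L.ξ (i + 1)) y)
      + L.g (L.ξ (i + 2)) x * (L.g y (L.φ (i + 1) z) + L.g (L.ξ i) z * L.g (L.ξ (i + 2)) y)
      - L.g (L.ξ i) y * (-L.g x z + L.g (L.ξ i) z * L.g (L.ξ i) x)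
      - L.g (L.ξ (i + 1)) y * (-L.g x (L.φ (i + 2) z) + L.g (L.ξ i) z * L.g (L.ξ (i + 1)) x)
      - L.g (L.ξ (i + 2)) y * (L.g x (L.φ (i + 1) z) + L.g (L.ξ i) z * L.g (L.ξ (i + 2)) x)
      - L.g (L.ξ (i + 2)) z * L.g x (L.φ (i + 1) y)
      + L.g (L.ξ (i + 1)) z * L.g x (L.φ (i + 2) y)) + 2 * (α - δ) * (
      L.g (L.ξ i) x * (-L.g (L.ξ (i + 1)) y * L.g (L.ξ (i + 1)) z
        - L.g (L.ξ (i + 2)) y * L.g (L.ξ (i + 2)) z)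
      + L.g (L.ξ i) y * (L.g (L.ξ (i + 1)) x * L.g (L.ξ (i + 1)) z
        + L.g (L.ξ (i + 2)) x * L.g (L.ξ (i + 2)) z)) := by
  rw [ThreeContactSpace.torsion, L.vol_eq i, Fin.sum_three_cyclic _ i]
  simp [g_ξ_φ, L.g_symm x (L.ξ _), L.g_symm y (L.ξ _)]
  ring

/-- The data at a point of a metric connection with torsion `T`: `F i u = ∇_u φ_i`,
`G i u = ∇_u ξ_i`, `Γ u v = ∇_u V` for commuting vector fields extending the vectors, subject to
the structure equation `dη_i = 2 α Φ_i + 2 (α - δ) η_{jk}` and to its exterior derivative. -/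
structure IsSasakiJet (α δ : ℝ) (F : Fin 3 → V →ₗ[ℝ] V →ₗ[ℝ] V) (G : Fin 3 → V →ₗ[ℝ] V)
    (Γ : V → V → V) : Prop where
  isVariation : ∀ u, L.IsVariation (F · u) (G · u)
  torsion : ∀ u v w, L.g (Γ u v - Γ v u) w = L.torsion α δ u v w
  d_η : ∀ i u v, (L.g (G i u) v + L.g (L.ξ i) (Γ u v)) - (L.g (G i v) u + L.g (L.ξ i) (Γ v u)) =
    2 * α * L.g u (L.φ i v) + 2 * (α - δ) * (L.g (L.ξ (i + 1)) u * L.g (L.ξ (i + 2)) v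
      - L.g (L.ξ (i + 1)) v * L.g (L.ξ (i + 2)) u)
  d_d_η : ∀ i u v w, (fun D : V → V → V → ℝ ↦ D u v w + D v w u + D w u v) (fun u v w ↦
    2 * α * (L.g (Γ u v) (L.φ i w) + L.g v (F i u w + L.φ i (Γ u w))) + 2 * (α - δ) *
      ((L.g (G (i + 1) u) v + L.g (L.ξ (i + 1)) (Γ u v)) * L.g (L.ξ (i + 2)) w
        + L.g (L.ξ (i + 1)) v * (L.g (G (i + 2) u) w + L.g (L.ξ (i + 2)) (Γ u w))
        - (L.g (G (i + 1) u) w + L.g (L.ξ (i + 1)) (Γ u w)) * L.g (L.ξ (i + 2)) v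
        - L.g (L.ξ (i + 1)) w * (L.g (G (i + 2) u) v + L.g (L.ξ (i + 2)) (Γ u v)))) = 0

-- The rotation is chosen so that it has the skew part of `G` and the cyclic sum of `F` forced by
-- the structure equation and its derivative; the difference then falls under `variation_eq_zero`.
variable {L} in
theorem IsSasakiJet.eq_rot {α δ : ℝ} (hα : α ≠ 0) {F : Fin 3 → V →ₗ[ℝ] V →ₗ[ℝ] V}
    {G : Fin 3 → V →ₗ[ℝ] V} {Γ : V → V → V} (h : L.IsSasakiJet α δ F G Γ) (i : Fin 3) (u : V) :
    F i u = L.rotφ (fun r ↦ 2 * (δ - 2 * α) * L.g (L.ξ r) u) i ∧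
      G i u = L.rotξ (fun r ↦ 2 * (δ - 2 * α) * L.g (L.ξ r) u) i := by
  -- Subtracting the torsion contribution η_i(T(u, v)) from dη_i leaves 2(α - δ) - 2(δ - 3α) = -4(δ
  -- - 2α) as coefficient of η_{jk}. A rotation of speed β has skew part -2β η_{jk}, whence β = 2(δ
  -- - 2α).
  have hG (i u v) : L.g (G i u) v - L.g (G i v) u =
      -(4 * (δ - 2 * α) * (L.g (L.ξ (i + 1)) u * L.g (L.ξ (i + 2)) v
      - L.g (L.ξ (i + 1)) v * L.g (L.ξ (i + 2)) u)) := by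
    have h1 := h.d_η i u v
    have h2 := h.torsion u v (L.ξ i)
    rw [torsion_ξ, L.g_symm, map_sub] at h2
    linear_combination h1 - h2
  let R (i : Fin 3) : V →ₗ[ℝ] V →ₗ[ℝ] V :=
    { toFun u := L.rotφ (fun r ↦ 2 * (δ - 2 * α) * L.g (L.ξ r) u) i
      map_add' u v := by simp [rotφ]; module
      map_smul' c u := by simp [rotφ]; module }
  let Q (i : Fin 3) : V →ₗ[ℝ] V :=
    { toFun u := L.rotξ (fun r ↦ 2 * (δ - 2 * α) * L.g (L.ξ r) u) i
      map_add' u v := by simp [rotξ]; module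
      map_smul' c u := by simp [rotξ]; module }
  have key := L.variation_eq_zero (fun i ↦ F i - R i) (fun i ↦ G i - Q i)
    (fun u ↦ (h.isVariation u).sub
      (L.isVariation_rot (fun r ↦ 2 * (δ - 2 * α) * L.g (L.ξ r) u))) ?_ ?_ i
  · exact ⟨sub_eq_zero.1 (congrArg (· u) key.1), sub_eq_zero.1 (congrArg (· u) key.2)⟩
  · intro i u v
    have := hG i u v
    simp [Q, rotξ]
    linear_combination this
  · intro i u v w
    have h1 := h.d_d_η i u v w
    simp only at h1
    have t (u v w) : L.g (Γ u v) w = L.g (Γ v u) w + L.torsion α δ u v w := by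
      rw [← h.torsion, map_sub, LinearMap.sub_apply]; ring
    have hF (u v w) : L.g (F i u v) w = -L.g v (F i u w) := (h.isVariation u).skew i v w
    have d1 := h.d_η (i + 1)
    have d2 := h.d_η (i + 2)
    have t1 := t u v (L.φ i w)
    have t2 := t v w (L.φ i u)
    have t3 := t w u (L.φ i v)
    simp only [map_add, L.g_φ_left i _ (Γ _ _)] at h1
    simp only [Fin.three_add_one_add_one, Fin.three_add_one_add_two, Fin.three_add_two_add_one,
      Fin.three_add_two_add_two] at d1 d2
    rw [L.torsion_φ] at t1 t2 t3
    have o (r) := And.intro (L.g_φ_left r v u) (And.intro (L.g_φ_left r w v) (L.g_φ_left r w u))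
    have o0 := o i
    have o1 := o (i + 1)
    have o2 := o (i + 2)
    have p1 := d1 u v
    have p2 := d1 v w
    have p3 := d1 w u
    have q1 := d2 u v
    have q2 := d2 v w
    have q3 := d2 w u
    -- In d(dη_i) = 0 the derivative of φ_i occurs only multiplied by α, so its cyclic sum is
    -- recovered because α ≠ 0.
    refine (mul_eq_zero.1 (?_ : α * _ = 0)).resolve_left hα
    simp [hF, R, rotφ, L.g_symm (L.φ _ _), -mul_eq_zero]
    simp only [o0, o1, o2, L.g_symm v u, L.g_symm w u, L.g_symm w v] at *
    linear_combination -(1 / 2) * h1 + α * (t1 + t2 + t3) + (α - δ) *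
      (L.g (L.ξ (i + 2)) w * p1 + L.g (L.ξ (i + 2)) u * p2 + L.g (L.ξ (i + 2)) v * p3
       - L.g (L.ξ (i + 1)) w * q1 - L.g (L.ξ (i + 1)) u * q2 - L.g (L.ξ (i + 1)) v * q3)

/-- A metric endomorphism-valued form with totally skew antisymmetrization that rotates the
`φ_i` vanishes. -/
theorem difference_eq_zero (hH : ∃ y ≠ 0, ∀ r, L.g (L.ξ r) y = 0) (D : V →ₗ[ℝ] V →ₗ[ℝ] V)
    (hm : ∀ u v w, L.g (D u v) w = -L.g v (D u w))
    (hs : ∀ u v w, L.g (D u v - D v u) w = -L.g (D u w - D w u) v) (c : ℝ)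
    (hφ : ∀ i u v, D u (L.φ i v) - L.φ i (D u v) =
      c • (L.g (L.ξ (i + 2)) u • L.φ (i + 1) v - L.g (L.ξ (i + 1)) u • L.φ (i + 2) v)) :
    D = 0 := by
  -- Skewness of D_u together with skewness of the torsion difference makes g(D_u v, w) totally
  -- skew.
  have cyc (u v w) : L.g (D u v) w = L.g (D w u) v := by
    have h1 := hs v u w
    have h2 := hm v u w
    have h3 := hm w u v
    have h4 := hm u v w
    simp only [map_sub, LinearMap.sub_apply, L.g_symm u, L.g_symm v] at *
    linarith
  have swap (u v w) : L.g (D u v) w = -L.g (D v u) w := by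
    rw [cyc, hm, L.g_symm, cyc v u w]
  have hξ (i u) : D u (L.ξ i) = c • (L.g (L.ξ (i + 2)) u • L.ξ (i + 1)
      - L.g (L.ξ (i + 1)) u • L.ξ (i + 2)) := by
    -- Applying φ_i to the commutator relation at ξ_i recovers D_u ξ_i up to its ξ_i-component,
    -- which vanishes by skewness.
    have h1 : L.g (L.ξ i) (D u (L.ξ i)) = 0 := by
      have := hm u (L.ξ i) (L.ξ i)
      rw [L.g_symm] at this
      linarith
    have h2 := congrArg (L.φ i) (hφ i u (L.ξ i))
    simp [h1] at h2
    rw [h2]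
  have hc : c = 0 := by
    obtain ⟨y, hy, hyξ⟩ := hH
    have h1 (i y) (hyξ : ∀ r, L.g (L.ξ r) y = 0) : D (L.ξ i) y = 0 := L.nondeg _ fun w ↦ by
      rw [swap, hξ]
      simp [hyξ]
    -- For i = 1 and u = ξ_0 the right hand side is c φ_2 y, while the left hand side vanishes since
    -- y and φ_1 y are horizontal.
    have h2 := hφ 1 (L.ξ 0) y
    rw [h1 0 y hyξ, h1 0 (L.φ 1 y) ?_] at h2
    · have h3 := congrArg (L.φ 2) h2
      rw [show (1 : Fin 3) + 2 = 0 from rfl, show (1 : Fin 3) + 1 = 2 from rfl] at h3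
      simpa [L.g_ξ, hyξ, hy] using h3
    · intro r
      rw [g_ξ_φ]
      fin_cases r
      · simpa [hyξ] using congrArg (L.g · y) (L.φ_succ_ξ 0)
      · simp
      · simpa [hyξ] using congrArg (L.g · y) (L.φ_ξ_succ 1)
  subst hc
  simp only [zero_smul, sub_eq_zero] at hφ hξ
  have hmove (i u v w) : L.g (D u (L.φ i v)) w = -L.g (D u v) (L.φ i w) := by
    rw [hφ, L.φ_skew]
  -- Moving φ_i out of the first slot through the cyclic symmetry gives one sign, through a
  -- transposition the other.
  have h0 (i u v w) : L.g (D u v) (L.φ i w) = 0 := by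
    have h1 : L.g (D (L.φ i u) v) w = L.g (D u v) (L.φ i w) := by
      rw [cyc, hmove, ← cyc u (L.φ i v) w, hmove, neg_neg]
    have h2 : L.g (D (L.φ i u) v) w = -L.g (D u v) (L.φ i w) := by
      rw [swap, hmove, swap v u, neg_neg]
    linarith
  ext u v
  refine L.nondeg _ fun w ↦ ?_
  -- Up to sign, w is φ_0² w plus a multiple of ξ_0, and D_u v is orthogonal to ξ_0 because D_u ξ_0
  -- = 0.
  have h1 := h0 0 u v (L.φ 0 w)
  have h2 := hm u v (L.ξ 0)
  rw [hξ, map_zero] at h2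
  simpa [h2] using h1

/-- The vector t = T(u, v) is known only through its inner products; the expansion involves nothing
but its pairings with ξ_r and φ_r. -/
theorem torsion_torsion (α δ : ℝ) (i : Fin 3) {t u v : V} (ht : ∀ w, L.g t w = L.torsion α δ u v w)
    (w z : V) : L.torsion α δ t w z = 2 * α * ∑ r, (L.torsion α δ u v (L.ξ r) * L.g w (L.φ r z)
      - L.g (L.ξ r) w * L.torsion α δ u v (L.φ r z) + L.g (L.ξ r) z * L.torsion α δ u v (L.φ r w))
    + 2 * (δ - α) * (L.torsion α δ u v (L.ξ i) * (L.g (L.ξ (i + 1)) w * L.g (L.ξ (i + 2)) z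
        - L.g (L.ξ (i + 1)) z * L.g (L.ξ (i + 2)) w)
      + L.torsion α δ u v (L.ξ (i + 1)) * (L.g (L.ξ (i + 2)) w * L.g (L.ξ i) z
        - L.g (L.ξ (i + 2)) z * L.g (L.ξ i) w)
      + L.torsion α δ u v (L.ξ (i + 2)) * (L.g (L.ξ i) w * L.g (L.ξ (i + 1)) z
        - L.g (L.ξ i) z * L.g (L.ξ (i + 1)) w)) := by
  simp only [← ht, L.g_symm t (L.ξ _)]
  rw [torsion, L.vol_eq i]
  ring

/-- The left hand side is dT when T is parallel. The factor 8α² against the 4α² of the theorem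
appears because Φ ∧ Φ counts each of the three pairings twice. -/
theorem sum_torsion_torsion (α δ : ℝ) {t : V → V → V}
    (ht : ∀ u v w, L.g (t u v) w = L.torsion α δ u v w) (u v w z : V) :
    L.torsion α δ (t u v) w z - L.torsion α δ (t u w) v z + L.torsion α δ (t u z) v w
      + L.torsion α δ (t v w) u z - L.torsion α δ (t v z) u w + L.torsion α δ (t w z) u v =
    8 * α ^ 2 * ∑ r, (L.g u (L.φ r v) * L.g w (L.φ r z) - L.g u (L.φ r w) * L.g v (L.φ r z)
      + L.g u (L.φ r z) * L.g v (L.φ r w))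
    + 8 * α * (δ - α) * ∑ r : Fin 3, (fun b : V → V → ℝ ↦
        L.g u (L.φ r v) * b w z - L.g u (L.φ r w) * b v z + L.g u (L.φ r z) * b v w
        + L.g v (L.φ r w) * b u z - L.g v (L.φ r z) * b u w + L.g w (L.φ r z) * b u v) (fun p q ↦
        L.g (L.ξ (r + 1)) p * L.g (L.ξ (r + 2)) q - L.g (L.ξ (r + 1)) q * L.g (L.ξ (r + 2)) p) := by
  -- The value is deliberately opaque: the cyclic identities are stated for i, i + 1, i + 2 with
  -- symbolic i.
  have i : Fin 3 := 0
  simp only [L.torsion_torsion α δ i (ht _ _)]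
  simp only [Fin.sum_three_cyclic _ i, torsion_φ, torsion_ξ, Fin.three_add_one_add_one,
    Fin.three_add_one_add_two, Fin.three_add_two_add_one, Fin.three_add_two_add_two,
    L.g_symm v u, L.g_symm w u, L.g_symm w v, L.g_symm z u, L.g_symm z v, L.g_symm z w,
    L.g_φ_left _ v u, L.g_φ_left _ w u, L.g_φ_left _ w v, L.g_φ_left _ z u, L.g_φ_left _ z v,
    L.g_φ_left _ z w]
  ring

end ThreeContactSpace

/-! ### Coordinate vector fields and the exterior derivative. -/

section Calculus

open Bundle Set Filter Topology VectorField

variable {E : Type*} [NormedAddCommGroup E] [NormedSpace ℝ E]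
  {M : Type*} [TopologicalSpace M] [ChartedSpace E M] [IsManifold 𝓘(ℝ, E) ∞ M]

/-- The vector field with constant coordinates `c` in the preferred chart at `x`. -/
noncomputable def coordField (x : M) (c : TangentSpace 𝓘(ℝ, E) x) (y : M) :
    TangentSpace 𝓘(ℝ, E) y :=
  (trivializationAt E (TangentSpace 𝓘(ℝ, E)) x).symmL ℝ y c

theorem coordField_extChartAt_symm {x : M} {y : E} (hy : y ∈ (extChartAt 𝓘(ℝ, E) x).target)
    (c : TangentSpace 𝓘(ℝ, E) x) : coordField x c ((extChartAt 𝓘(ℝ, E) x).symm y) =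
      (mfderiv 𝓘(ℝ, E) 𝓘(ℝ, E) (extChartAt 𝓘(ℝ, E) x).symm y : E →L[ℝ] E) c := by
  have hy' : (extChartAt 𝓘(ℝ, E) x).symm y ∈ (chartAt E x).source := by
    simpa using (extChartAt 𝓘(ℝ, E) x).map_target hy
  rw [coordField, TangentBundle.symmL_trivializationAt hy', ← mfderivWithin_univ,
    ModelWithCorners.range_eq_univ]
  exact congrArg (fun z ↦ (mfderivWithin 𝓘(ℝ, E) 𝓘(ℝ, E) (extChartAt 𝓘(ℝ, E) x).symm univ z :
    E →L[ℝ] E) c) ((extChartAt 𝓘(ℝ, E) x).right_inv hy)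

@[simp]
theorem coordField_self (x : M) (c : TangentSpace 𝓘(ℝ, E) x) : coordField x c x = c := by
  rw [coordField, TangentBundle.symmL_trivializationAt (mem_chart_source E x),
    mfderivWithin_range_extChartAt_symm]
  rfl

theorem mfderiv_extChartAt_coordField {x y : M} (hy : y ∈ (chartAt E x).source)
    (c : TangentSpace 𝓘(ℝ, E) x) :
    mfderiv 𝓘(ℝ, E) 𝓘(ℝ, E) (extChartAt 𝓘(ℝ, E) x) y (coordField x c y) = c := by
  rw [coordField, TangentBundle.symmL_trivializationAt hy]
  exact congrArg (fun A : E →L[ℝ] E ↦ A c)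
    (mfderiv_extChartAt_comp_mfderivWithin_extChartAt_symm' (I := 𝓘(ℝ, E)) (by simpa using hy))

theorem contMDiffAt_coordField {x y : M} (hy : y ∈ (chartAt E x).source)
    (c : TangentSpace 𝓘(ℝ, E) x) : ContMDiffAt 𝓘(ℝ, E) (𝓘(ℝ, E).prod 𝓘(ℝ, E)) ∞
      (fun y ↦ TotalSpace.mk' E y (coordField x c y)) y := by
  have h : y ∈ (trivializationAt E (TangentSpace 𝓘(ℝ, E)) x).baseSet := by simpa using hy
  rw [Trivialization.contMDiffAt_section_iff (F := E)
    (E := fun y : M ↦ TangentSpace 𝓘(ℝ, E) y)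
    (e := trivializationAt E (fun y : M ↦ TangentSpace 𝓘(ℝ, E) y) x) h]
  refine (contMDiffAt_const (I' := 𝓘(ℝ, E)) (M' := E) (c := c)).congr_of_eventuallyEq ?_
  filter_upwards [(trivializationAt E (TangentSpace 𝓘(ℝ, E)) x).open_baseSet.mem_nhds h] with z hz
  have := (trivializationAt E (fun y : M ↦ TangentSpace 𝓘(ℝ, E) y) x).apply_mk_symm hz c
  have h' : coordField x c z =
      (trivializationAt E (fun y : M ↦ TangentSpace 𝓘(ℝ, E) y) x).symm z c :=
    Trivialization.symmL_apply _ hz c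
  rw [h']
  exact congrArg Prod.snd this

theorem mdifferentiableAt_coordField (x : M) (c : TangentSpace 𝓘(ℝ, E) x) :
    VFDiffAt (coordField x c) x :=
  (contMDiffAt_coordField (mem_chart_source E x) c).mdifferentiableAt (by simp)

/-- In the chart the fields are constant. Hence at x the torsion is the skew part of ∇ on coordinate
fields, and bracket terms drop out of exterior derivatives. -/
theorem mlieBracket_coordField (x : M) (c d : TangentSpace 𝓘(ℝ, E) x) :
    mlieBracket 𝓘(ℝ, E) (coordField x c) (coordField x d) x = 0 := by
  have h (c : TangentSpace 𝓘(ℝ, E) x) : mpullbackWithin 𝓘(ℝ, E) 𝓘(ℝ, E)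
      (extChartAt 𝓘(ℝ, E) x).symm (coordField x c) univ =ᶠ[𝓝 (extChartAt 𝓘(ℝ, E) x x)]
        fun _ ↦ (c : E) := by
    filter_upwards [extChartAt_target_mem_nhds x] with y hy
    have := isInvertible_mfderivWithin_extChartAt_symm hy
    rw [ModelWithCorners.range_eq_univ] at this
    rw [mpullbackWithin_apply, coordField_extChartAt_symm hy, ← mfderivWithin_univ]
    exact this.inverse_apply_self (c : E)
  rw [mlieBracket, mlieBracketWithin_apply, ModelWithCorners.range_eq_univ, preimage_univ,
    inter_univ]
  have : lieBracketWithin ℝ (mpullbackWithin 𝓘(ℝ, E) 𝓘(ℝ, E)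
      (extChartAt 𝓘(ℝ, E) x).symm (coordField x c) univ) (mpullbackWithin 𝓘(ℝ, E) 𝓘(ℝ, E)
      (extChartAt 𝓘(ℝ, E) x).symm (coordField x d) univ) univ (extChartAt 𝓘(ℝ, E) x x) = 0 := by
    refine (congrFun (lieBracketWithin_univ (𝕜 := ℝ)) _).trans ?_
    refine ((h c).lieBracket_vectorField_eq (h d)).trans ?_
    have hc (c d : E) : lieBracket ℝ (fun _ : E ↦ c) (fun _ ↦ d) = 0 := by
      ext; simp [lieBracket]
    exact congrFun (hc c d) _
  exact (congrArg _ this).trans (map_zero _)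

/-- The form `a`, read in the preferred chart at `x`. -/
noncomputable def DiffForm.inChart {k : ℕ} (a : DiffForm E M k) (x : M) : E → E [⋀^Fin k]→L[ℝ] ℝ :=
  fun y ↦ (a ((extChartAt 𝓘(ℝ, E) x).symm y)).compContinuousLinearMap
      (mfderiv 𝓘(ℝ, E) 𝓘(ℝ, E) (extChartAt 𝓘(ℝ, E) x).symm y)

theorem DiffForm.extD_eq {k : ℕ} (a : DiffForm E M k) (x : M) :
    a.extD x = extDeriv (a.inChart x) (extChartAt 𝓘(ℝ, E) x x) := by
  ext v
  rw [DiffForm.extD, mfderiv_extChartAt_self]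
  rfl

/-- Smoothness at `x`, through the components in the preferred chart at `x`. -/
def DiffForm.IsSmoothAt {k : ℕ} (a : DiffForm E M k) (x : M) : Prop :=
  ∀ v : Fin k → TangentSpace 𝓘(ℝ, E) x, ContMDiffAt 𝓘(ℝ, E) 𝓘(ℝ, ℝ) ∞
    (fun y ↦ a y (fun j ↦ coordField x (v j) y)) x

theorem DiffForm.inChart_apply {k : ℕ} (a : DiffForm E M k) (x : M) {y : E}
    (hy : y ∈ (extChartAt 𝓘(ℝ, E) x).target) (v : Fin k → TangentSpace 𝓘(ℝ, E) x) :
    a.inChart x y v = (fun z ↦ a z (fun j ↦ coordField x (v j) z))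
      ((extChartAt 𝓘(ℝ, E) x).symm y) := by
  simp only [coordField_extChartAt_symm hy]
  rfl

theorem DiffForm.inChart_apply_eventuallyEq {k : ℕ} (a : DiffForm E M k) (x : M)
    (v : Fin k → TangentSpace 𝓘(ℝ, E) x) :
    (fun y ↦ a.inChart x y v) =ᶠ[𝓝 (extChartAt 𝓘(ℝ, E) x x)]
      fun y ↦ (fun z ↦ a z (fun j ↦ coordField x (v j) z)) ((extChartAt 𝓘(ℝ, E) x).symm y) := by
  filter_upwards [extChartAt_target_mem_nhds x] with y hy using a.inChart_apply x hy v

omit [IsManifold 𝓘(ℝ, E) ∞ M] in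
theorem fderiv_comp_extChartAt_symm (f : M → ℝ) {x : M}
    (hf : MDifferentiableAt 𝓘(ℝ, E) 𝓘(ℝ, ℝ) f x) :
    fderiv ℝ (fun y ↦ f ((extChartAt 𝓘(ℝ, E) x).symm y)) (extChartAt 𝓘(ℝ, E) x x) =
      mvfderiv 𝓘(ℝ, E) f x := by
  ext v
  simp [mvfderiv, mfderiv, hf, writtenInExtChartAt, Function.comp_def]
  rfl

/-- An alternating form is determined linearly by its values on basis vectors; a linear left inverse
of this evaluation map transfers smoothness. -/
theorem contDiffAt_continuousAlternatingMap [FiniteDimensional ℝ E] {k : ℕ}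
    {a : E → E [⋀^Fin k]→L[ℝ] ℝ} {x : E}
    (h : ∀ v : Fin k → E, ContDiffAt ℝ ∞ (fun y ↦ a y v) x) : ContDiffAt ℝ ∞ a x := by
  let b := Module.finBasis ℝ E
  let J : (E [⋀^Fin k]→L[ℝ] ℝ) →ₗ[ℝ] ((Fin k → Fin (Module.finrank ℝ E)) → ℝ) :=
    { toFun f s := f (fun j ↦ b (s j))
      map_add' _ _ := rfl
      map_smul' _ _ := rfl }
  have hJ : LinearMap.ker J = ⊥ := by
    refine LinearMap.ker_eq_bot'.2 fun f hf ↦ ?_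
    have : f.toAlternatingMap = 0 := b.ext_alternating fun s _ ↦ congrFun hf s
    ext v
    exact congrArg (· v) this
  obtain ⟨K, hK⟩ := J.exists_leftInverse_of_injective hJ
  have : a = fun y ↦ LinearMap.toContinuousLinearMap K (J (a y)) := by
    ext1 y
    exact (congrArg (· (a y)) hK).symm
  rw [this]
  refine (LinearMap.toContinuousLinearMap K).contDiff.contDiffAt.comp x ?_
  exact contDiffAt_pi.2 fun s ↦ h _

theorem DiffForm.IsSmoothAt.contDiffAt [FiniteDimensional ℝ E] {k : ℕ} {a : DiffForm E M k} {x : M}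
    (h : a.IsSmoothAt x) : ContDiffAt ℝ ∞ (a.inChart x) (extChartAt 𝓘(ℝ, E) x x) := by
  refine contDiffAt_continuousAlternatingMap fun v ↦ ?_
  have := ((h v).contMDiffWithinAt (s := univ))
  rw [contMDiffWithinAt_iff] at this
  exact (this.2.contDiffAt (by simp)).congr_of_eventuallyEq (a.inChart_apply_eventuallyEq x v)

theorem DiffForm.IsSmoothAt.extD_apply [FiniteDimensional ℝ E] {k : ℕ} {a : DiffForm E M k} {x : M}
    (h : a.IsSmoothAt x) (v : Fin (k + 1) → TangentSpace 𝓘(ℝ, E) x) :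
    a.extD x v = ∑ i, (-1) ^ i.val * mvfderiv 𝓘(ℝ, E)
      (fun y ↦ a y (fun j ↦ coordField x (i.removeNth v j) y)) x (v i) := by
  rw [a.extD_eq]
  refine (extDeriv_apply (h.contDiffAt.differentiableAt (by simp)) v).trans ?_
  refine Finset.sum_congr rfl fun i _ ↦ ?_
  refine (zsmul_eq_mul _ _).trans ?_
  push_cast
  refine congrArg (fun A : E →L[ℝ] ℝ ↦ (-1) ^ i.val * A (v i))
    ((a.inChart_apply_eventuallyEq x (i.removeNth v)).fderiv_eq.trans ?_)
  exact fderiv_comp_extChartAt_symm _ ((h _).mdifferentiableAt (by simp))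

theorem coordField_mfderiv_extChartAt {x y : M} (hy : y ∈ (chartAt E x).source)
    (v : TangentSpace 𝓘(ℝ, E) y) :
    coordField x ((mfderiv 𝓘(ℝ, E) 𝓘(ℝ, E) (extChartAt 𝓘(ℝ, E) x) y : E →L[ℝ] E) v) y = v := by
  have h : y ∈ (trivializationAt E (TangentSpace 𝓘(ℝ, E)) x).baseSet := by simpa using hy
  have := (trivializationAt E (TangentSpace 𝓘(ℝ, E)) x).symmL_continuousLinearMapAt (R := ℝ) h v
  rw [TangentBundle.continuousLinearMapAt_trivializationAt hy] at this
  exact this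

theorem contDiffAt_coord_change {x z : M} {w : E} (hw : w ∈ (extChartAt 𝓘(ℝ, E) z).target)
    (hx : (extChartAt 𝓘(ℝ, E) z).symm w ∈ (chartAt E x).source) :
    ContDiffAt ℝ ∞ (extChartAt 𝓘(ℝ, E) x ∘ (extChartAt 𝓘(ℝ, E) z).symm) w := by
  rw [← contMDiffAt_iff_contDiffAt]
  refine ContMDiffAt.comp w (contMDiffAt_extChartAt' hx) ?_
  exact (contMDiffOn_extChartAt_symm z).contMDiffAt
    ((isOpen_extChartAt_target z).mem_nhds hw)

theorem fderiv_coord_change {x z : M} {w : E} (hw : w ∈ (extChartAt 𝓘(ℝ, E) z).target)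
    (hx : (extChartAt 𝓘(ℝ, E) z).symm w ∈ (chartAt E x).source) (v : E) :
    fderiv ℝ (extChartAt 𝓘(ℝ, E) x ∘ (extChartAt 𝓘(ℝ, E) z).symm) w v =
      (mfderiv 𝓘(ℝ, E) 𝓘(ℝ, E) (extChartAt 𝓘(ℝ, E) x) ((extChartAt 𝓘(ℝ, E) z).symm w) : E →L[ℝ] E)
        (coordField z v ((extChartAt 𝓘(ℝ, E) z).symm w)) := by
  refine Eq.trans ?_ (congrArg (mfderiv 𝓘(ℝ, E) 𝓘(ℝ, E) (extChartAt 𝓘(ℝ, E) x)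
    ((extChartAt 𝓘(ℝ, E) z).symm w) : E →L[ℝ] E) (coordField_extChartAt_symm hw v)).symm
  rw [← mfderiv_eq_fderiv]
  have h1 := (contMDiffOn_extChartAt_symm (I := 𝓘(ℝ, E)) (n := ∞) z).contMDiffAt
    ((isOpen_extChartAt_target z).mem_nhds hw)
  exact congrArg (fun A : E →L[ℝ] E ↦ A v) (mfderiv_comp w
    ((contMDiffAt_extChartAt' (n := ∞) hx).mdifferentiableAt (by simp))
    (h1.mdifferentiableAt (by simp)))

/-- `extD` uses a different chart at each point. Naturality of `extDeriv` under coordinate changes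
shows that near x the form `a.extD`, read in the chart at x, is the model exterior derivative of `a`
read in that one chart; then d² = 0 in the model space applies. -/
theorem DiffForm.extD_extD [FiniteDimensional ℝ E] {k : ℕ} {a : DiffForm E M k} {x : M}
    (h : a.IsSmoothAt x) : a.extD.extD x = 0 := by
  have key : a.extD.inChart x =ᶠ[𝓝 (extChartAt 𝓘(ℝ, E) x x)] extDeriv (a.inChart x) := by
    filter_upwards [extChartAt_target_mem_nhds x,
      (h.contDiffAt.of_le (m := 2) ENat.LEInfty.out).eventually (by simp)] with y hy hay
    have hzs : (extChartAt 𝓘(ℝ, E) x).symm y ∈ (chartAt E x).source := by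
      simpa using (extChartAt 𝓘(ℝ, E) x).map_target hy
    have hyz := (extChartAt 𝓘(ℝ, E) x).right_inv hy
    ext v
    refine (a.extD.inChart_apply x hy v).trans ?_
    generalize (extChartAt 𝓘(ℝ, E) x).symm y = z at hzs hyz
    have hτz : (extChartAt 𝓘(ℝ, E) x ∘ (extChartAt 𝓘(ℝ, E) z).symm)
        (extChartAt 𝓘(ℝ, E) z z) = y := by
      rw [← hyz]
      exact congrArg (extChartAt 𝓘(ℝ, E) x) (extChartAt_to_inv z)
    have hτs : (extChartAt 𝓘(ℝ, E) z).symm (extChartAt 𝓘(ℝ, E) z z) ∈ (chartAt E x).source := by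
      rwa [extChartAt_to_inv]
    -- Near z, reading the form in the chart at z is the pullback of its reading in the chart at x
    -- by the coordinate change.
    have hin : a.inChart z =ᶠ[𝓝 (extChartAt 𝓘(ℝ, E) z z)]
        fun w ↦ (a.inChart x ((extChartAt 𝓘(ℝ, E) x ∘ (extChartAt 𝓘(ℝ, E) z).symm)
          w)).compContinuousLinearMap
            (fderiv ℝ (extChartAt 𝓘(ℝ, E) x ∘ (extChartAt 𝓘(ℝ, E) z).symm) w) := by
      filter_upwards [extChartAt_target_mem_nhds z, (continuousAt_extChartAt_symm z).eventually_mem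
        ((chartAt E x).open_source.mem_nhds hτs)] with w hw hwx
      have hτw : (extChartAt 𝓘(ℝ, E) x ∘ (extChartAt 𝓘(ℝ, E) z).symm) w ∈
          (extChartAt 𝓘(ℝ, E) x).target :=
        (extChartAt 𝓘(ℝ, E) x).map_source (by simpa using hwx)
      ext u
      refine (a.inChart_apply z hw u).trans ?_
      refine Eq.trans ?_ (a.inChart_apply x hτw (fun j ↦
        fderiv ℝ (extChartAt 𝓘(ℝ, E) x ∘ (extChartAt 𝓘(ℝ, E) z).symm) w (u j))).symm
      rw [show (extChartAt 𝓘(ℝ, E) x).symm ((extChartAt 𝓘(ℝ, E) x ∘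
          (extChartAt 𝓘(ℝ, E) z).symm) w) = (extChartAt 𝓘(ℝ, E) z).symm w from
        (extChartAt 𝓘(ℝ, E) x).left_inv (by simpa using hwx)]
      refine congrArg (a _) (funext fun j ↦ ?_)
      refine (coordField_mfderiv_extChartAt hwx _).symm.trans ?_
      exact congrArg (coordField x · _) (fderiv_coord_change hw hwx (u j)).symm
    refine (congrArg (fun b : E [⋀^Fin (k + 1)]→L[ℝ] ℝ ↦ b (fun j ↦ coordField x (v j) z))
      (a.extD_eq z)).trans ?_
    rw [hin.extDeriv_eq, extDeriv_pullback (r := 2)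
      (by rw [hτz]; exact hay.differentiableAt (by simp))
      ((contDiffAt_coord_change (mem_extChartAt_target z) hτs).of_le ENat.LEInfty.out)
      (by simp), hτz]
    refine congrArg (extDeriv (a.inChart x) y) (funext fun j ↦ ?_)
    refine (fderiv_coord_change (mem_extChartAt_target z) hτs _).trans ?_
    rw [extChartAt_to_inv]
    rw [coordField_self]
    exact mfderiv_extChartAt_coordField hzs (v j)
  rw [DiffForm.extD_eq, key.extDeriv_eq]
  exact extDeriv_extDeriv_apply h.contDiffAt (by simpa using ENat.LEInfty.out)

end Calculus

/-! ### Smoothness criteria through coordinate fields. -/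

section Smoothness

open Bundle Set Filter Topology VectorField

variable {E : Type*} [NormedAddCommGroup E] [NormedSpace ℝ E]
  {M : Type*} [TopologicalSpace M] [ChartedSpace E M]

theorem contMDiffAt_clm_of_apply [FiniteDimensional ℝ E] {F : Type*} [NormedAddCommGroup F]
    [NormedSpace ℝ F] {A : M → E →L[ℝ] F} {x : M}
    (h : ∀ c, ContMDiffAt 𝓘(ℝ, E) 𝓘(ℝ, F) ∞ (fun y ↦ A y c) x) :
    ContMDiffAt 𝓘(ℝ, E) 𝓘(ℝ, E →L[ℝ] F) ∞ A x := by
  let b := Module.finBasis ℝ E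
  have : A = fun y ↦ ∑ i, ContinuousLinearMap.smulRightL ℝ E F
      (LinearMap.toContinuousLinearMap (b.coord i)) (A y (b i)) := by
    ext y v
    conv_lhs => rw [← b.sum_repr v, map_sum]
    simp
  rw [this]
  refine contMDiffAt_finsetSum fun i _ ↦ ?_
  exact (ContinuousLinearMap.smulRightL ℝ E F
    (LinearMap.toContinuousLinearMap (b.coord i))).contMDiff.contMDiffAt.comp x (h (b i))

variable [IsManifold 𝓘(ℝ, E) ∞ M]

/-- The coordinates of a tangent vector in the preferred chart at `x`. -/
noncomputable def chartCoord (x y : M) : TangentSpace 𝓘(ℝ, E) y →L[ℝ] E :=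
  (trivializationAt E (TangentSpace 𝓘(ℝ, E)) x).continuousLinearMapAt ℝ y

theorem coordField_chartCoord {x y : M} (hy : y ∈ (chartAt E x).source)
    (v : TangentSpace 𝓘(ℝ, E) y) : coordField (E := E) x (chartCoord (E := E) x y v) y = v :=
  (trivializationAt E (TangentSpace 𝓘(ℝ, E)) x).symmL_continuousLinearMapAt (R := ℝ)
    (by simpa using hy) v

theorem chartCoord_coordField {x y : M} (hy : y ∈ (chartAt E x).source)
    (c : E) : chartCoord (E := E) x y (coordField (E := E) x c y) = c :=
  (trivializationAt E (TangentSpace 𝓘(ℝ, E)) x).continuousLinearMapAt_symmL (R := ℝ)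
    (by simpa using hy) c

theorem contMDiffAt_vectorField_iff {W : ∀ y : M, TangentSpace 𝓘(ℝ, E) y} {x : M} :
    ContMDiffAt 𝓘(ℝ, E) (𝓘(ℝ, E).prod 𝓘(ℝ, E)) ∞ (fun y ↦ TotalSpace.mk' E y (W y)) x ↔
      ContMDiffAt 𝓘(ℝ, E) 𝓘(ℝ, E) ∞ (fun y ↦ chartCoord x y (W y)) x := by
  have h : x ∈ (trivializationAt E (fun y : M ↦ TangentSpace 𝓘(ℝ, E) y) x).baseSet :=
    FiberBundle.mem_baseSet_trivializationAt' x
  rw [Trivialization.contMDiffAt_section_iff (F := E) (E := fun y : M ↦ TangentSpace 𝓘(ℝ, E) y)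
    (e := trivializationAt E (fun y : M ↦ TangentSpace 𝓘(ℝ, E) y) x) h]
  refine Filter.EventuallyEq.contMDiffAt_iff ?_
  filter_upwards [(trivializationAt E (fun y : M ↦ TangentSpace 𝓘(ℝ, E) y) x).open_baseSet.mem_nhds
    h] with z hz
  exact (Trivialization.continuousLinearMapAt_apply_of_mem (R := ℝ) _ hz (W z)).symm

theorem contMDiffAt_covector [FiniteDimensional ℝ E] {a : ∀ y : M, TangentSpace 𝓘(ℝ, E) y →L[ℝ] ℝ}
    {x : M} (h : ∀ c : TangentSpace 𝓘(ℝ, E) x,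
      ContMDiffAt 𝓘(ℝ, E) 𝓘(ℝ, ℝ) ∞ (fun y ↦ a y (coordField x c y)) x) :
    ContMDiffAt 𝓘(ℝ, E) (𝓘(ℝ, E).prod 𝓘(ℝ, E →L[ℝ] ℝ)) ∞
      (fun y ↦ TotalSpace.mk' (E →L[ℝ] ℝ) y (a y)) x := by
  rw [contMDiffAt_hom_bundle]
  refine ⟨contMDiffAt_id, contMDiffAt_clm_of_apply fun c ↦ (h c).congr_of_eventuallyEq ?_⟩
  refine Filter.Eventually.of_forall fun y ↦ ?_
  exact congrArg (fun B : ℝ →L[ℝ] ℝ ↦ B (a y (coordField x c y)))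
    (Trivial.continuousLinearMapAt_trivialization ℝ M ℝ y)

theorem contMDiffAt_endomorphism [FiniteDimensional ℝ E]
    {A : ∀ y : M, TangentSpace 𝓘(ℝ, E) y →L[ℝ] TangentSpace 𝓘(ℝ, E) y}
    {x : M} (h : ∀ c : TangentSpace 𝓘(ℝ, E) x, ContMDiffAt 𝓘(ℝ, E) (𝓘(ℝ, E).prod 𝓘(ℝ, E)) ∞
      (fun y ↦ TotalSpace.mk' E y (A y (coordField x c y))) x) :
    ContMDiffAt 𝓘(ℝ, E) (𝓘(ℝ, E).prod 𝓘(ℝ, E →L[ℝ] E)) ∞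
      (fun y ↦ TotalSpace.mk' (E →L[ℝ] E) y (A y)) x := by
  rw [contMDiffAt_hom_bundle]
  refine ⟨contMDiffAt_id, contMDiffAt_clm_of_apply fun c ↦
    (contMDiffAt_vectorField_iff.1 (h c)).congr_of_eventuallyEq ?_⟩
  exact Filter.Eventually.of_forall fun y ↦ rfl

/-- The derivative of a smooth function along a smooth vector field is smooth. -/
theorem contMDiffAt_mvfderiv_apply [FiniteDimensional ℝ E] {f : M → ℝ} {x : M}
    (hf : ContMDiffAt 𝓘(ℝ, E) 𝓘(ℝ, ℝ) ∞ f x) {W : ∀ y : M, TangentSpace 𝓘(ℝ, E) y}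
    (hW : ContMDiffAt 𝓘(ℝ, E) (𝓘(ℝ, E).prod 𝓘(ℝ, E)) ∞ (fun y ↦ TotalSpace.mk' E y (W y)) x) :
    ContMDiffAt 𝓘(ℝ, E) 𝓘(ℝ, ℝ) ∞ (fun y ↦ mvfderiv 𝓘(ℝ, E) f y (W y)) x := by
  have h : ContMDiffAt 𝓘(ℝ, E) (𝓘(ℝ, E).prod 𝓘(ℝ, E →L[ℝ] ℝ)) ∞
      (fun y ↦ TotalSpace.mk' (E →L[ℝ] ℝ) y (mvfderiv 𝓘(ℝ, E) f y)) x := by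
    refine contMDiffAt_covector fun c ↦ ?_
    have h1 := hf.contMDiffWithinAt (s := univ)
    rw [contMDiffWithinAt_iff] at h1
    have h2 : ContDiffAt ℝ ∞ (fun y ↦ f ((extChartAt 𝓘(ℝ, E) x).symm y))
        (extChartAt 𝓘(ℝ, E) x x) := h1.2.contDiffAt (by simp)
    have h3 : ContDiffAt ℝ ∞ (fun w ↦ fderiv ℝ (fun y ↦ f ((extChartAt 𝓘(ℝ, E) x).symm y)) w c)
        (extChartAt 𝓘(ℝ, E) x x) := (h2.fderiv_right (m := ∞) (by simp)).clm_apply contDiffAt_const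
    refine ((h3.contMDiffAt).comp x
      (contMDiffAt_extChartAt (I := 𝓘(ℝ, E)))).congr_of_eventuallyEq ?_
    filter_upwards [(chartAt E x).open_source.mem_nhds (mem_chart_source E x),
      (contMDiffAt_iff_contMDiffAt_nhds (n := 1) (by simp)).1
        (hf.of_le ENat.LEInfty.out)] with y hy hfy
    have hys : y ∈ (extChartAt 𝓘(ℝ, E) x).source := by simpa using hy
    have h4 := (extChartAt 𝓘(ℝ, E) x).map_source hys
    have h5 := (extChartAt 𝓘(ℝ, E) x).left_inv hys
    change _ = fderiv ℝ (fun y ↦ f ((extChartAt 𝓘(ℝ, E) x).symm y)) (extChartAt 𝓘(ℝ, E) x y) c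
    generalize extChartAt 𝓘(ℝ, E) x y = w at h4 h5
    subst h5
    rw [coordField_extChartAt_symm h4, ← mfderiv_eq_fderiv]
    have h6 := (contMDiffOn_extChartAt_symm (I := 𝓘(ℝ, E)) (n := ∞) x).contMDiffAt
      ((isOpen_extChartAt_target x).mem_nhds h4)
    exact congrArg (fun A : E →L[ℝ] ℝ ↦ A c) (mfderiv_comp w
      (hfy.mdifferentiableAt (by simp)) (h6.mdifferentiableAt (by simp))).symm
  have := h.clm_bundle_apply hW
  simp only [contMDiffAt_totalSpace] at this
  exact this.2

theorem isInvertible_of_injective {E : Type*} [NormedAddCommGroup E] [NormedSpace ℝ E]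
    [FiniteDimensional ℝ E] {A : E →L[ℝ] E →L[ℝ] ℝ} (hA : Function.Injective A) :
    A.IsInvertible := by
  have h : Module.finrank ℝ E = Module.finrank ℝ (E →L[ℝ] ℝ) := by
    rw [← (LinearMap.toContinuousLinearMap : (E →ₗ[ℝ] ℝ) ≃ₗ[ℝ] E →L[ℝ] ℝ).finrank_eq]
    exact (Subspace.dual_finrank_eq (K := ℝ)).symm
  exact ⟨(LinearEquiv.ofInjectiveOfFinrankEq A.toLinearMap hA h).toContinuousLinearEquiv, rfl⟩

variable (g : ContMDiffRiemannianMetric 𝓘(ℝ, E) ∞ E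
  (fun x : M ↦ TangentSpace 𝓘(ℝ, E) x))

theorem Bundle.ContMDiffRiemannianMetric.eq_zero_of_inner_eq_zero (x : M)
    {v : TangentSpace 𝓘(ℝ, E) x} (h : ∀ w, g.inner x v w = 0) : v = 0 := by
  by_contra hv
  exact (g.pos x v hv).ne' (h v)

theorem Bundle.ContMDiffRiemannianMetric.isInvertible [FiniteDimensional ℝ E] (x : M) :
    (g.inner x).IsInvertible :=
  isInvertible_of_injective (E := E) <| (injective_iff_map_eq_zero (g.inner x)).2 fun _ hv ↦
    g.eq_zero_of_inner_eq_zero x fun w ↦ congrArg (· w) hv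

theorem contMDiffAt_inner {V W : ∀ y : M, TangentSpace 𝓘(ℝ, E) y} {x : M}
    (hV : ContMDiffAt 𝓘(ℝ, E) (𝓘(ℝ, E).prod 𝓘(ℝ, E)) ∞ (fun y ↦ TotalSpace.mk' E y (V y)) x)
    (hW : ContMDiffAt 𝓘(ℝ, E) (𝓘(ℝ, E).prod 𝓘(ℝ, E)) ∞ (fun y ↦ TotalSpace.mk' E y (W y)) x) :
    ContMDiffAt 𝓘(ℝ, E) 𝓘(ℝ, ℝ) ∞ (fun y ↦ g.inner y (V y) (W y)) x := by
  have := ContMDiffAt.clm_bundle_apply₂ (F₁ := E) (F₂ := E) (F₃ := ℝ)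
    (E₃ := Bundle.Trivial M ℝ) g.contMDiff.contMDiffAt hV hW
  simp only [contMDiffAt_totalSpace] at this
  exact this.2

theorem mdifferentiableAt_inner {V W : ∀ y : M, TangentSpace 𝓘(ℝ, E) y} {x : M}
    (hV : VFDiffAt V x) (hW : VFDiffAt W x) :
    MDifferentiableAt 𝓘(ℝ, E) 𝓘(ℝ, ℝ) (fun y ↦ g.inner y (V y) (W y)) x := by
  have := MDifferentiableAt.clm_bundle_apply₂ (F₁ := E) (F₂ := E) (F₃ := ℝ)
    (E₃ := Bundle.Trivial M ℝ) (g.contMDiff.mdifferentiableAt (x := x) (by simp)) hV hW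
  simp only [mdifferentiableAt_totalSpace] at this
  exact this.2

/-- A vector field is smooth if its inner products with the coordinate fields are. -/
theorem contMDiffAt_of_inner_coordField [FiniteDimensional ℝ E]
    {W : ∀ y : M, TangentSpace 𝓘(ℝ, E) y} {x : M}
    (h : ∀ c : TangentSpace 𝓘(ℝ, E) x,
      ContMDiffAt 𝓘(ℝ, E) 𝓘(ℝ, ℝ) ∞ (fun y ↦ g.inner y (W y) (coordField x c y)) x) :
    ContMDiffAt 𝓘(ℝ, E) (𝓘(ℝ, E).prod 𝓘(ℝ, E)) ∞ (fun y ↦ TotalSpace.mk' E y (W y)) x := by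
  -- The Gram operator of the metric in coordinates: W is recovered by applying its inverse to the
  -- covector g(W, ·), and inversion of operators is smooth.
  let G (y : M) : E →L[ℝ] E →L[ℝ] ℝ := ContinuousLinearMap.inCoordinates E
    (fun y : M ↦ TangentSpace 𝓘(ℝ, E) y) (E →L[ℝ] ℝ) (fun y : M ↦ TangentSpace 𝓘(ℝ, E) y →L[ℝ] ℝ)
    x y x y (g.inner y)
  have hG : ContMDiffAt 𝓘(ℝ, E) 𝓘(ℝ, E →L[ℝ] E →L[ℝ] ℝ) ∞ G x :=
    ((contMDiffAt_hom_bundle _).1 (g.contMDiff.contMDiffAt (x := x))).2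
  have hGe {y : M} (hy : y ∈ (chartAt E x).source) (c d : E) :
      G y c d = g.inner y (coordField x c y) (coordField x d y) := by
    have hb : y ∈ (trivializationAt E (fun y : M ↦ TangentSpace 𝓘(ℝ, E) y) x).baseSet := by
      simpa using hy
    have hc (c : E) : coordField x c y =
        (trivializationAt E (fun y : M ↦ TangentSpace 𝓘(ℝ, E) y) x).symm y c :=
      Trivialization.symmL_apply _ hb c
    refine (inCoordinates_apply_eq₂ (F₃ := ℝ) (E₃ := Bundle.Trivial M ℝ) hb hb (by simp)).trans ?_
    rw [hc, hc]
    simp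
  have hGi {y : M} (hy : y ∈ (chartAt E x).source) : (G y).IsInvertible := by
    refine isInvertible_of_injective <| (injective_iff_map_eq_zero (G y)).2 fun v hv ↦ ?_
    rw [← chartCoord_coordField hy v]
    by_contra hne
    have hne' : coordField x v y ≠ 0 := fun h0 ↦ hne (by rw [h0, map_zero])
    refine (g.pos y _ hne').ne' ?_
    rw [← hGe hy, hv]
    rfl
  let w (y : M) : E →L[ℝ] ℝ := G y (chartCoord x y (W y))
  have hw : ContMDiffAt 𝓘(ℝ, E) 𝓘(ℝ, E →L[ℝ] ℝ) ∞ w x := by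
    refine contMDiffAt_clm_of_apply fun c ↦ (h c).congr_of_eventuallyEq ?_
    filter_upwards [(chartAt E x).open_source.mem_nhds (mem_chart_source E x)] with y hy
    refine (hGe hy _ _).trans ?_
    rw [coordField_chartCoord hy]
  have hinv : ContMDiffAt 𝓘(ℝ, E) 𝓘(ℝ, (E →L[ℝ] ℝ) →L[ℝ] E) ∞ (fun y ↦ (G y).inverse) x := by
    obtain ⟨e, he⟩ := hGi (mem_chart_source E x)
    have h1 := contDiffAt_map_inverse (n := ∞) e
    rw [he] at h1
    exact h1.contMDiffAt.comp x hG
  rw [contMDiffAt_vectorField_iff]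
  refine (hinv.clm_apply hw).congr_of_eventuallyEq ?_
  filter_upwards [(chartAt E x).open_source.mem_nhds (mem_chart_source E x)] with y hy
  exact ((hGi hy).inverse_apply_self _).symm

end Smoothness

/-- Skew-symmetric trilinear forms. -/
structure IsSkewTrilinear {V : Type*} [AddCommGroup V] [Module ℝ V] (τ : V → V → V → ℝ) : Prop where
  add_left : ∀ u u' v w, τ (u + u') v w = τ u v w + τ u' v w
  smul_left : ∀ (c : ℝ) u v w, τ (c • u) v w = c * τ u v w
  swap_left : ∀ u v w, τ v u w = -τ u v w
  swap_right : ∀ u v w, τ u w v = -τ u v w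

namespace IsSkewTrilinear

variable {V : Type*} [AddCommGroup V] [Module ℝ V] {τ : V → V → V → ℝ} (h : IsSkewTrilinear τ)
include h

theorem add_mid (u v v' w) : τ u (v + v') w = τ u v w + τ u v' w := by
  rw [h.swap_left, h.add_left, h.swap_left u, h.swap_left u]; ring

theorem smul_mid (c : ℝ) (u v w) : τ u (c • v) w = c * τ u v w := by
  rw [h.swap_left, h.smul_left, h.swap_left u]; ring

theorem add_right (u v w w') : τ u v (w + w') = τ u v w + τ u v w' := by
  rw [h.swap_right, h.add_mid, h.swap_right u v, h.swap_right u v]; ring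

theorem smul_right (c : ℝ) (u v w) : τ u v (c • w) = c * τ u v w := by
  rw [h.swap_right, h.smul_mid, h.swap_right u v]; ring

end IsSkewTrilinear

/-! ### The metric connection with a prescribed skew torsion. -/

section Koszul

open Bundle Set Filter Topology VectorField

variable {E : Type*} [NormedAddCommGroup E] [NormedSpace ℝ E]
  {M : Type*} [TopologicalSpace M] [ChartedSpace E M] [IsManifold 𝓘(ℝ, E) ∞ M]
  (g : ContMDiffRiemannianMetric 𝓘(ℝ, E) ∞ E (fun x : M ↦ TangentSpace 𝓘(ℝ, E) x))

/-- The derivative of `g(U, V)`. -/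
noncomputable def dInner (U V : ∀ y : M, TangentSpace 𝓘(ℝ, E) y) (x : M) :
    TangentSpace 𝓘(ℝ, E) x →L[ℝ] ℝ :=
  mvfderiv 𝓘(ℝ, E) (fun y ↦ g.inner y (U y) (V y)) x

variable {U U' V V' W W' : ∀ y : M, TangentSpace 𝓘(ℝ, E) y} {x : M} {f : M → ℝ}

theorem dInner_comm (U V : ∀ y : M, TangentSpace 𝓘(ℝ, E) y) : dInner g U V = dInner g V U := by
  ext1 x
  simp only [dInner, g.symm _ (U _)]

theorem dInner_add_left (hU : VFDiffAt U x) (hU' : VFDiffAt U' x) (hV : VFDiffAt V x)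
    (w : TangentSpace 𝓘(ℝ, E) x) :
    dInner g (U + U') V x w = dInner g U V x w + dInner g U' V x w := by
  have := mvfderiv_fun_add (mdifferentiableAt_inner g hU hV) (mdifferentiableAt_inner g hU' hV)
  simpa [dInner] using congrArg (· w) this

theorem dInner_smul_left (hf : MDifferentiableAt 𝓘(ℝ, E) 𝓘(ℝ, ℝ) f x) (hU : VFDiffAt U x)
    (hV : VFDiffAt V x) (w : TangentSpace 𝓘(ℝ, E) x) :
    dInner g (f • U) V x w =
      f x * dInner g U V x w + g.inner x (U x) (V x) * mvfderiv 𝓘(ℝ, E) f x w := by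
  have := mvfderiv_fun_mul hf (mdifferentiableAt_inner g hU hV)
  simpa [dInner] using congrArg (· w) this

theorem dInner_add_right (hU : VFDiffAt U x) (hV : VFDiffAt V x) (hV' : VFDiffAt V' x)
    (w : TangentSpace 𝓘(ℝ, E) x) :
    dInner g U (V + V') x w = dInner g U V x w + dInner g U V' x w := by
  rw [dInner_comm, dInner_add_left g hV hV' hU, dInner_comm, dInner_comm g V']

theorem dInner_smul_right (hf : MDifferentiableAt 𝓘(ℝ, E) 𝓘(ℝ, ℝ) f x) (hU : VFDiffAt U x)
    (hV : VFDiffAt V x) (w : TangentSpace 𝓘(ℝ, E) x) :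
    dInner g U (f • V) x w =
      f x * dInner g U V x w + g.inner x (U x) (V x) * mvfderiv 𝓘(ℝ, E) f x w := by
  rw [dInner_comm, dInner_smul_left g hf hV hU, dInner_comm, g.symm]

variable (τ : ∀ x : M, TangentSpace 𝓘(ℝ, E) x → TangentSpace 𝓘(ℝ, E) x →
  TangentSpace 𝓘(ℝ, E) x → ℝ)

/-- The right hand side of the Koszul formula for the metric connection with torsion `τ`. -/
noncomputable def koszul (U V W : ∀ y : M, TangentSpace 𝓘(ℝ, E) y) (x : M) : ℝ :=
  dInner g V W x (U x) + dInner g U W x (V x) - dInner g U V x (W x)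
    + g.inner x (mlieBracket 𝓘(ℝ, E) U V x) (W x) - g.inner x (mlieBracket 𝓘(ℝ, E) U W x) (V x)
    - g.inner x (mlieBracket 𝓘(ℝ, E) V W x) (U x) + τ x (U x) (V x) (W x)

variable {τ} [FiniteDimensional ℝ E]

/-- The derivatives of f coming from the inner products cancel those coming from the brackets. -/
theorem tensorialAt_koszul_left (hτ : ∀ x, IsSkewTrilinear (τ x)) (hV : VFDiffAt V x)
    (hW : VFDiffAt W x) : TensorialAt 𝓘(ℝ, E) E (fun U ↦ koszul g τ U V W x) x where
  smul {f U} hf hU := by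
    simp only [koszul, dInner_smul_left g hf hU hV, dInner_smul_left g hf hU hW,
      mlieBracket_smul_left hf hU, Pi.smul_apply', map_smul, map_add, add_apply,
      smul_apply, (hτ x).smul_left, smul_eq_mul]
    ring
  add {U U'} hU hU' := by
    simp only [koszul, dInner_add_left g hU hU' hV, dInner_add_left g hU hU' hW,
      mlieBracket_add_left hU hU', Pi.add_apply, map_add, add_apply, (hτ x).add_left]
    ring

/-- In the differentiated slot the derivative terms add up instead of cancelling; halving the factor
2 gives the Leibniz rule. -/
theorem koszul_smul_mid (hτ : ∀ x, IsSkewTrilinear (τ x))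
    (hf : MDifferentiableAt 𝓘(ℝ, E) 𝓘(ℝ, ℝ) f x) (hU : VFDiffAt U x) (hV : VFDiffAt V x)
    (hW : VFDiffAt W x) : koszul g τ U (f • V) W x =
      f x * koszul g τ U V W x + 2 * (mvfderiv 𝓘(ℝ, E) f x (U x) * g.inner x (V x) (W x)) := by
  simp only [koszul, dInner_smul_left g hf hV hW, dInner_smul_right g hf hU hV,
    mlieBracket_smul_left hf hV, mlieBracket_smul_right hf hV, Pi.smul_apply', map_smul, map_add,
    add_apply, smul_apply, (hτ x).smul_mid, smul_eq_mul, g.symm x (V x) (U x)]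
  ring

theorem koszul_add_mid (hτ : ∀ x, IsSkewTrilinear (τ x)) (hU : VFDiffAt U x) (hV : VFDiffAt V x)
    (hV' : VFDiffAt V' x) (hW : VFDiffAt W x) :
    koszul g τ U (V + V') W x = koszul g τ U V W x + koszul g τ U V' W x := by
  simp only [koszul, dInner_add_left g hV hV' hW, dInner_add_right g hU hV hV',
    mlieBracket_add_left hV hV', mlieBracket_add_right hV hV', Pi.add_apply, map_add,
    add_apply, (hτ x).add_mid]
  ring

theorem tensorialAt_koszul_right (hτ : ∀ x, IsSkewTrilinear (τ x)) (hU : VFDiffAt U x)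
    (hV : VFDiffAt V x) : TensorialAt 𝓘(ℝ, E) E (fun W ↦ koszul g τ U V W x) x where
  smul {f W} hf hW := by
    simp only [koszul, dInner_smul_right g hf hV hW, dInner_smul_right g hf hU hW,
      mlieBracket_smul_right hf hW, Pi.smul_apply', map_smul, map_add, add_apply,
      smul_apply, (hτ x).smul_right, smul_eq_mul, g.symm x (W x)]
    ring
  add {W W'} hW hW' := by
    simp only [koszul, dInner_add_right g hV hW hW', dInner_add_right g hU hW hW',
      mlieBracket_add_right hW hW', Pi.add_apply, map_add, add_apply, (hτ x).add_right]
    ring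

open scoped Classical in
/-- The metric connection with torsion `τ`. -/
noncomputable def koszulNabla (hτ : ∀ x, IsSkewTrilinear (τ x))
    (Y : ∀ y : M, TangentSpace 𝓘(ℝ, E) y) (x : M) :
    TangentSpace 𝓘(ℝ, E) x →L[ℝ] TangentSpace 𝓘(ℝ, E) x :=
  if hY : VFDiffAt Y x then
    (g.inner x).inverse ∘L ((1 / 2 : ℝ) • TensorialAt.mkHom₂ (fun U W ↦ koszul g τ U Y W x) x
      (fun _ hW ↦ tensorialAt_koszul_left g hτ hY hW)
      (fun _ hU ↦ tensorialAt_koszul_right g hτ hU hY))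
  -- A default value: a covariant derivative is constrained on differentiable fields only, which is
  -- also where uniqueness is asserted.
  else 0

theorem inner_koszulNabla (hτ : ∀ x, IsSkewTrilinear (τ x)) (hU : VFDiffAt U x)
    (hV : VFDiffAt V x) (hW : VFDiffAt W x) :
    g.inner x (koszulNabla g hτ V x (U x)) (W x) = 1 / 2 * koszul g τ U V W x := by
  rw [koszulNabla, dif_pos hV]
  simp only [ContinuousLinearMap.comp_apply, (g.isInvertible x).self_apply_inverse]
  simp only [smul_apply, TensorialAt.mkHom₂_apply _ _ hU hW, smul_eq_mul]

omit [FiniteDimensional ℝ E] in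
variable {g} in
/-- Vectors are equal when their inner products with all differentiable fields are. -/
theorem eq_of_inner_eq {v w : TangentSpace 𝓘(ℝ, E) x}
    (h : ∀ W : ∀ y : M, TangentSpace 𝓘(ℝ, E) y, VFDiffAt W x →
      g.inner x v (W x) = g.inner x w (W x)) : v = w := by
  rw [← sub_eq_zero]
  refine g.eq_zero_of_inner_eq_zero x fun c ↦ ?_
  have := h _ (mdifferentiableAt_coordField x c)
  rw [coordField_self] at this
  rw [map_sub, sub_apply, this, sub_self]

/-- The metric connection with torsion `τ`. -/
noncomputable def koszulConnection (hτ : ∀ x, IsSkewTrilinear (τ x)) : Connection E M where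
  toFun := koszulNabla g hτ
  isCovariantDerivativeOnUniv :=
    { add := by
        intro Y Y' x hY hY' _
        ext u
        refine eq_of_inner_eq (g := g) fun W hW ↦ ?_
        have hU := mdifferentiableAt_coordField x u
        rw [← coordField_self x u]
        simp only [add_apply, map_add]
        rw [inner_koszulNabla g hτ hU (mdifferentiableAt_add_section hY hY') hW,
          inner_koszulNabla g hτ hU hY hW, inner_koszulNabla g hτ hU hY' hW,
          koszul_add_mid g hτ hU hY hY' hW]
        ring
      leibniz := by
        intro Y f x hY hf _
        ext u
        refine eq_of_inner_eq (g := g) fun W hW ↦ ?_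
        have hU := mdifferentiableAt_coordField x u
        rw [← coordField_self x u]
        simp only [add_apply, smul_apply, map_add, map_smul,
          ContinuousLinearMap.smulRight_apply]
        rw [inner_koszulNabla g hτ hU (hf.smul_section hY) hW,
          inner_koszulNabla g hτ hU hY hW, koszul_smul_mid g hτ hf hU hY hW]
        simp only [smul_eq_mul]
        ring }

theorem inner_koszulConnection (hτ : ∀ x, IsSkewTrilinear (τ x)) (hU : VFDiffAt U x)
    (hV : VFDiffAt V x) (hW : VFDiffAt W x) :
    g.inner x (koszulConnection g hτ V x (U x)) (W x) = 1 / 2 * koszul g τ U V W x :=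
  inner_koszulNabla g hτ hU hV hW

/-- Exchanging V and W in the Koszul expression and adding leaves only the derivative of g(V, W),
twice; τ drops out because it is skew. -/
theorem koszulConnection_metric (hτ : ∀ x, IsSkewTrilinear (τ x)) (hV : VFDiffAt V x)
    (hW : VFDiffAt W x) (u : TangentSpace 𝓘(ℝ, E) x) :
    mvfderiv 𝓘(ℝ, E) (fun y ↦ g.inner y (V y) (W y)) x u =
      g.inner x (koszulConnection g hτ V x u) (W x)
        + g.inner x (V x) (koszulConnection g hτ W x u) := by
  have hU := mdifferentiableAt_coordField x u
  rw [← coordField_self x u, g.symm x (V x), inner_koszulConnection g hτ hU hV hW,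
    inner_koszulConnection g hτ hU hW hV, koszul, koszul, (hτ x).swap_right _ (V x),
    dInner_comm g W, mlieBracket_swap (V := W) (W := V), Pi.neg_apply, map_neg,
    neg_apply]
  simp only [dInner]
  ring

/-- Exchanging U and V and subtracting leaves the bracket and τ, each twice. -/
theorem koszulConnection_torsion (hτ : ∀ x, IsSkewTrilinear (τ x))
    (u v w : TangentSpace 𝓘(ℝ, E) x) :
    g.inner x ((koszulConnection g hτ).torsion x u v) w = τ x u v w := by
  have hU := mdifferentiableAt_coordField x u
  have hV := mdifferentiableAt_coordField x v
  have hW := mdifferentiableAt_coordField x w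
  rw [← coordField_self x u, ← coordField_self x v, ← coordField_self x w,
    CovariantDerivative.torsion_apply _ hU hV]
  simp only [map_sub, sub_apply]
  rw [inner_koszulConnection g hτ hU hV hW, inner_koszulConnection g hτ hV hU hW, koszul, koszul,
    (hτ x).swap_left (coordField x u x), dInner_comm g (coordField x v) (coordField x u),
    mlieBracket_swap (V := coordField x v) (W := coordField x u), Pi.neg_apply, map_neg,
    neg_apply]
  ring

theorem contMDiff_koszulConnection (hτ : ∀ x, IsSkewTrilinear (τ x))
    (hs : ∀ (x : M) (U V W : ∀ y : M, TangentSpace 𝓘(ℝ, E) y),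
      ContMDiffAt 𝓘(ℝ, E) (𝓘(ℝ, E).prod 𝓘(ℝ, E)) ∞ (fun y ↦ TotalSpace.mk' E y (U y)) x →
      ContMDiffAt 𝓘(ℝ, E) (𝓘(ℝ, E).prod 𝓘(ℝ, E)) ∞ (fun y ↦ TotalSpace.mk' E y (V y)) x →
      ContMDiffAt 𝓘(ℝ, E) (𝓘(ℝ, E).prod 𝓘(ℝ, E)) ∞ (fun y ↦ TotalSpace.mk' E y (W y)) x →
      ContMDiffAt 𝓘(ℝ, E) 𝓘(ℝ, ℝ) ∞ (fun y ↦ τ y (U y) (V y) (W y)) x) :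
    (koszulConnection g hτ).ContMDiffCovariantDerivative ∞ := by
  refine ⟨⟨fun {Y} hY x _ ↦ ContMDiffAt.contMDiffWithinAt ?_⟩⟩
  have hYs (z : M) : ContMDiffAt 𝓘(ℝ, E) (𝓘(ℝ, E).prod 𝓘(ℝ, E)) ∞
      (fun y ↦ TotalSpace.mk' E y (Y y)) z := (hY.contMDiffAt univ_mem).of_le (by simp)
  refine contMDiffAt_endomorphism fun c ↦ contMDiffAt_of_inner_coordField g fun d ↦ ?_
  have hc := contMDiffAt_coordField (mem_chart_source E x) c
  have hd := contMDiffAt_coordField (mem_chart_source E x) d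
  have hb {U V : ∀ y : M, TangentSpace 𝓘(ℝ, E) y}
      (hU : ContMDiffAt 𝓘(ℝ, E) (𝓘(ℝ, E).prod 𝓘(ℝ, E)) ∞ (fun y ↦ TotalSpace.mk' E y (U y)) x)
      (hV : ContMDiffAt 𝓘(ℝ, E) (𝓘(ℝ, E).prod 𝓘(ℝ, E)) ∞ (fun y ↦ TotalSpace.mk' E y (V y)) x) :
      ContMDiffAt 𝓘(ℝ, E) (𝓘(ℝ, E).prod 𝓘(ℝ, E)) ∞
        (fun y ↦ TotalSpace.mk' E y (mlieBracket 𝓘(ℝ, E) U V y)) x :=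
    haveI : IsManifold 𝓘(ℝ, E) (minSmoothness ℝ 2) M := by
      rw [minSmoothness_of_isRCLikeNormedField]
      exact .of_le (n := ∞) ENat.LEInfty.out
    haveI : IsManifold 𝓘(ℝ, E) ((⊤ : ℕ∞) + 1) M := ‹IsManifold 𝓘(ℝ, E) ∞ M›
    ContMDiffAt.mlieBracket_vectorField (m := ⊤) (n := ⊤) hU hV (by simp)
  have hk : ContMDiffAt 𝓘(ℝ, E) 𝓘(ℝ, ℝ) ∞
      (fun y ↦ 1 / 2 * koszul g τ (coordField x c) Y (coordField x d) y) x := by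
    refine contMDiffAt_const.mul ?_
    exact ((((((contMDiffAt_mvfderiv_apply (contMDiffAt_inner g (hYs x) hd) hc).add
      (contMDiffAt_mvfderiv_apply (contMDiffAt_inner g hc hd) (hYs x))).sub
      (contMDiffAt_mvfderiv_apply (contMDiffAt_inner g hc (hYs x)) hd)).add
      (contMDiffAt_inner g (hb hc (hYs x)) hd)).sub
      (contMDiffAt_inner g (hb hc hd) (hYs x))).sub
      (contMDiffAt_inner g (hb (hYs x) hd) hc)).add (hs x _ _ _ hc (hYs x) hd)
  refine hk.congr_of_eventuallyEq ?_
  filter_upwards [(chartAt E x).open_source.mem_nhds (mem_chart_source E x)] with y hy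
  exact inner_koszulConnection g hτ ((contMDiffAt_coordField hy c).mdifferentiableAt (by simp))
    ((hYs y).mdifferentiableAt (by simp))
    ((contMDiffAt_coordField hy d).mdifferentiableAt (by simp))

end Koszul

/-! ### Tangent spaces as 3-contact spaces, and the forms evaluated on them. -/

namespace AlmostThreeContactMetricStructure

section Pointwise

variable {E : Type*} [NormedAddCommGroup E] [NormedSpace ℝ E]
  {M : Type*} [TopologicalSpace M] [ChartedSpace E M] [IsManifold 𝓘(ℝ, E) ∞ M]
  (S : AlmostThreeContactMetricStructure E M)

theorem φ_ξ_self (i : Fin 3) (x : M) : S.φ i x (S.ξ i x) = 0 := by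
  have h1 : S.φ i x (S.φ i x (S.ξ i x)) = 0 := by
    rw [(S.str i).φ_φ, (S.str i).η_ξ]; simp
  have h2 := (S.str i).φ_φ x (S.φ i x (S.ξ i x))
  rw [h1, map_zero, eq_comm, neg_add_eq_zero] at h2
  have h3 := h1
  rw [h2, map_smul] at h3
  rcases smul_eq_zero.1 h3 with h | h
  · rw [h2, h, zero_smul]
  · exact h

theorem inner_ξ (i : Fin 3) (x : M) (w : TangentSpace 𝓘(ℝ, E) x) :
    S.g.inner x (S.ξ i x) w = S.η i x w := by
  have := S.compatible i x w (S.ξ i x)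
  rw [S.φ_ξ_self, map_zero, (S.str i).η_ξ] at this
  rw [S.g.symm]
  linarith

theorem inner_φ (i : Fin 3) (x : M) (v w : TangentSpace 𝓘(ℝ, E) x) :
    S.g.inner x (S.φ i x v) w = -S.g.inner x v (S.φ i x w) := by
  have h := S.g_φ_self i x (v + w)
  simp only [map_add, add_apply, S.g_φ_self] at h
  rw [S.g.symm]
  linarith

theorem inner_ξ_ξ (i j : Fin 3) (x : M) :
    S.g.inner x (S.ξ i x) (S.ξ j x) = if i = j then 1 else 0 := by
  have h1 (i : Fin 3) : S.η (i + 2) x (S.ξ (i + 1) x) = 0 := by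
    exact (S.η_eq i x _).trans ((congrArg _ (S.φ_ξ_self (i + 1) x)).trans (map_zero _))
  have h2 (i : Fin 3) : S.η (i + 2) x (S.ξ i x) = 0 := by
    refine (S.η_eq' i x _).trans (neg_eq_zero.2 ?_)
    exact (congrArg _ (S.φ_ξ_self i x)).trans (map_zero _)
  rw [inner_ξ]
  fin_cases i <;> fin_cases j
  exacts [(S.str 0).η_ξ x, h2 1, h1 1, h1 2, (S.str 1).η_ξ x, h2 2, h2 0, h1 0, (S.str 2).η_ξ x]

/-- The almost 3-contact metric structure of the tangent space at `x`. -/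
noncomputable def tangent (x : M) : ThreeContactSpace (TangentSpace 𝓘(ℝ, E) x) where
  g := LinearMap.mk₂ ℝ (fun v w ↦ S.g.inner x v w) (by simp) (by simp) (by simp) (by simp)
  φ i := S.φ i x
  ξ i := S.ξ i x
  g_symm := S.g.symm x
  nondeg v := S.g.eq_zero_of_inner_eq_zero x
  φ_skew i := S.inner_φ i x
  g_ξ i j := S.inner_ξ_ξ i j x
  φ_φ_self i v := ((S.str i).φ_φ x v).trans (by rw [LinearMap.mk₂_apply, inner_ξ])
  φ_φ_succ i v := by
    have := S.φ_eq i x v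
    rw [LinearMap.mk₂_apply, inner_ξ]
    exact (eq_add_of_sub_eq this.symm)
  φ_succ_φ i v := by
    have := S.φ_eq' i x v
    rw [LinearMap.mk₂_apply, inner_ξ]
    change S.φ (i + 1) x (S.φ i x v) = -(S.str (i + 2)).φ x v + S.η i x v • S.ξ (i + 1) x
    rw [this]
    abel
  φ_ξ_self i := S.φ_ξ_self i x
  φ_ξ_succ i := (S.ξ_eq i x).symm
  φ_succ_ξ i := (neg_eq_iff_eq_neg.2 (S.ξ_eq' i x)).symm

theorem tangent_g (x : M) (v w : TangentSpace 𝓘(ℝ, E) x) :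
    (S.tangent x).g v w = S.g.inner x v w := rfl

theorem tangent_φ (x : M) (i : Fin 3) (v : TangentSpace 𝓘(ℝ, E) x) :
    (S.tangent x).φ i v = S.φ i x v := rfl

theorem η_eq_tangent (x : M) (i : Fin 3) (v : TangentSpace 𝓘(ℝ, E) x) :
    S.η i x v = (S.tangent x).g ((S.tangent x).ξ i) v := (S.inner_ξ i x v).symm

theorem ηForm_apply (i : Fin 3) (x : M) (v : Fin 1 → TangentSpace 𝓘(ℝ, E) x) :
    S.ηForm i x v = (S.tangent x).g ((S.tangent x).ξ i) (v 0) := (S.inner_ξ i x _).symm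

theorem Φ_apply (i : Fin 3) (x : M) (v : Fin 2 → TangentSpace 𝓘(ℝ, E) x) :
    S.Φ i x v = (S.tangent x).g (v 0) ((S.tangent x).φ i (v 1)) := rfl

theorem η₂_apply (j k : Fin 3) (x : M) (v : Fin 2 → TangentSpace 𝓘(ℝ, E) x) :
    S.η₂ j k x v =
      (S.tangent x).g ((S.tangent x).ξ j) (v 0) * (S.tangent x).g ((S.tangent x).ξ k) (v 1)
        - (S.tangent x).g ((S.tangent x).ξ j) (v 1) *
          (S.tangent x).g ((S.tangent x).ξ k) (v 0) := by
  refine (altWedge_one_one _ _ v).trans ?_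
  simp only [ηForm_apply]
  rfl

theorem η₁₂₃_apply (x : M) (v : Fin 3 → TangentSpace 𝓘(ℝ, E) x) :
    S.η₁₂₃ x v = (S.tangent x).vol (v 0) (v 1) (v 2) := by
  refine (altWedge_one_two _ _ v).trans ?_
  simp only [ηForm_apply, η₂_apply]
  rfl

theorem hProj_apply (x : M) (v : TangentSpace 𝓘(ℝ, E) x) :
    S.hProj x v = v - ∑ i, (S.tangent x).g ((S.tangent x).ξ i) v • (S.tangent x).ξ i := by
  simp only [hProj, sub_apply, sum_apply, ContinuousLinearMap.smulRight_apply, η_eq_tangent]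
  rfl

/-- The vertical part of Φ_i is -η_{jk}, since φ_i acts on the span of ξ_j, ξ_k by a quarter turn
and kills ξ_i. -/
theorem ΦH_apply (i : Fin 3) (x : M) (v : Fin 2 → TangentSpace 𝓘(ℝ, E) x) :
    S.ΦH i x v = (S.tangent x).g (v 0) ((S.tangent x).φ i (v 1))
      + ((S.tangent x).g ((S.tangent x).ξ (i + 1)) (v 0) *
          (S.tangent x).g ((S.tangent x).ξ (i + 2)) (v 1)
        - (S.tangent x).g ((S.tangent x).ξ (i + 1)) (v 1) *
          (S.tangent x).g ((S.tangent x).ξ (i + 2)) (v 0)) := by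
  have h : S.ΦH i x v = (S.tangent x).g (S.hProj x (v 0)) ((S.tangent x).φ i (S.hProj x (v 1))) :=
    rfl
  rw [h, hProj_apply, hProj_apply, Fin.sum_three_cyclic _ i, Fin.sum_three_cyclic _ i]
  generalize v 0 = u
  generalize v 1 = w
  generalize S.tangent x = L
  simp [L.g_ξ, L.g_ξ_φ, L.g_symm u (L.ξ _)]
  ring

theorem _root_.ThreeContactSpace.isSkewTrilinear_torsion {V : Type*} [AddCommGroup V] [Module ℝ V]
    (L : ThreeContactSpace V) (α δ : ℝ) : IsSkewTrilinear (L.torsion α δ) where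
  add_left u u' v w := by
    simp only [ThreeContactSpace.torsion, ThreeContactSpace.vol, map_add, LinearMap.add_apply,
      Fin.sum_univ_three]
    ring
  smul_left c u v w := by
    simp only [ThreeContactSpace.torsion, ThreeContactSpace.vol, map_smul, LinearMap.smul_apply,
      Fin.sum_univ_three, smul_eq_mul]
    ring
  swap_left u v w := by
    simp only [ThreeContactSpace.torsion, ThreeContactSpace.vol, Fin.sum_univ_three,
      L.g_φ_left _ v u]
    ring
  swap_right u v w := by
    simp only [ThreeContactSpace.torsion, ThreeContactSpace.vol, Fin.sum_univ_three,
      L.g_φ_left _ w v]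
    ring

/-- The torsion form of the canonical connection. -/
noncomputable def torsionForm (α δ : ℝ) : DiffForm E M 3 :=
  (2 * α) • ∑ i, (S.ηForm i).wedge (S.ΦH i) + (2 * (δ - 4 * α)) • S.η₁₂₃

/-- Replacing Φ_i^H by Φ_i + η_{jk} adds 6α η_{123}, which turns 2(δ - 4α) into the 2(δ - α) of
`ThreeContactSpace.torsion`. -/
theorem torsionForm_apply (α δ : ℝ) (x : M) (v : Fin 3 → TangentSpace 𝓘(ℝ, E) x) :
    S.torsionForm α δ x v = (S.tangent x).torsion α δ (v 0) (v 1) (v 2) := by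
  have h (i : Fin 3) : (S.ηForm i).wedge (S.ΦH i) x v = _ := altWedge_one_two _ _ v
  have h' : S.torsionForm α δ x v = 2 * α * ∑ i, (S.ηForm i).wedge (S.ΦH i) x v
      + 2 * (δ - 4 * α) * S.η₁₂₃ x v := by
    simp [torsionForm]
  rw [h', η₁₂₃_apply]
  simp only [h, ηForm_apply, ΦH_apply]
  simp [Fin.sum_univ_three, ThreeContactSpace.torsion, ThreeContactSpace.vol]
  ring

variable {S} {α δ : ℝ}

theorem IsThreeSasaki.extD_ηForm_apply (hS : S.IsThreeSasaki α δ) (i : Fin 3) (x : M)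
    (v : Fin 2 → TangentSpace 𝓘(ℝ, E) x) :
    (S.ηForm i).extD x v = 2 * α * (S.tangent x).g (v 0) ((S.tangent x).φ i (v 1))
      + 2 * (α - δ) * ((S.tangent x).g ((S.tangent x).ξ (i + 1)) (v 0) *
          (S.tangent x).g ((S.tangent x).ξ (i + 2)) (v 1)
        - (S.tangent x).g ((S.tangent x).ξ (i + 1)) (v 1) *
          (S.tangent x).g ((S.tangent x).ξ (i + 2)) (v 0)) := by
  rw [hS.d_η, ← Φ_apply, ← η₂_apply]
  rfl

/-- The η_{jk} terms of dη_i add up to 6(α - δ) η_{123}, and 6(α - δ) + 8(δ - α) = 2(δ - α). -/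
theorem IsThreeSasaki.torsionForm_eq (hS : S.IsThreeSasaki α δ) : S.torsionForm α δ =
    ∑ i, (S.ηForm i).wedge (S.ηForm i).extD + (8 * (δ - α)) • S.η₁₂₃ := by
  funext x
  ext v
  have h (i : Fin 3) : (S.ηForm i).wedge (S.ηForm i).extD x v = _ := altWedge_one_two _ _ v
  have h' : (∑ i, (S.ηForm i).wedge (S.ηForm i).extD + (8 * (δ - α)) • S.η₁₂₃ : DiffForm E M 3) x v
      = ∑ i, (S.ηForm i).wedge (S.ηForm i).extD x v + 8 * (δ - α) * S.η₁₂₃ x v := by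
    simp
  refine Eq.trans ?_ h'.symm
  rw [torsionForm_apply, η₁₂₃_apply]
  simp only [h, ηForm_apply, hS.extD_ηForm_apply]
  simp [Fin.sum_univ_three, ThreeContactSpace.torsion, ThreeContactSpace.vol]
  ring

end Pointwise

end AlmostThreeContactMetricStructure

/-! ### Calculus rules for directional and covariant derivatives. -/

section DirectionalDerivatives

open Bundle

variable {E : Type*} [NormedAddCommGroup E] [NormedSpace ℝ E]
  {M : Type*} [TopologicalSpace M] [ChartedSpace E M]

/-- The function `f` is differentiable at `x`, with derivative `r` along `u`. -/
def HasDirDeriv (f : M → ℝ) (x : M) (u : TangentSpace 𝓘(ℝ, E) x) (r : ℝ) : Prop :=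
  MDifferentiableAt 𝓘(ℝ, E) 𝓘(ℝ, ℝ) f x ∧ mvfderiv 𝓘(ℝ, E) f x u = r

namespace HasDirDeriv

variable {f f' : M → ℝ} {x : M} {u : TangentSpace 𝓘(ℝ, E) x} {r r' : ℝ}

theorem unique (h : HasDirDeriv f x u r) (h' : HasDirDeriv f x u r') : r = r' :=
  h.2.symm.trans h'.2

theorem congr (h : HasDirDeriv f x u r) (hf : ∀ y, f' y = f y) : HasDirDeriv f' x u r := by
  rwa [show f' = f from funext hf]

theorem const (c : ℝ) (x : M) (u : TangentSpace 𝓘(ℝ, E) x) : HasDirDeriv (fun _ ↦ c) x u 0 :=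
  ⟨mdifferentiableAt_const, by rw [mvfderiv_const]; rfl⟩

theorem add (h : HasDirDeriv f x u r) (h' : HasDirDeriv f' x u r') :
    HasDirDeriv (fun y ↦ f y + f' y) x u (r + r') :=
  ⟨h.1.add h'.1, by rw [mvfderiv_fun_add h.1 h'.1, add_apply, h.2, h'.2]⟩

theorem sub (h : HasDirDeriv f x u r) (h' : HasDirDeriv f' x u r') :
    HasDirDeriv (fun y ↦ f y - f' y) x u (r - r') :=
  ⟨h.1.sub h'.1, by rw [mvfderiv_fun_sub h.1 h'.1, sub_apply, h.2, h'.2]⟩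

theorem neg (h : HasDirDeriv f x u r) : HasDirDeriv (fun y ↦ -f y) x u (-r) :=
  ⟨h.1.neg, by rw [mvfderiv_fun_neg, neg_apply, h.2]⟩

theorem mul (h : HasDirDeriv f x u r) (h' : HasDirDeriv f' x u r') :
    HasDirDeriv (fun y ↦ f y * f' y) x u (r * f' x + f x * r') :=
  ⟨h.1.mul h'.1, by
    rw [mvfderiv_fun_mul h.1 h'.1, add_apply, smul_apply, smul_apply, h.2, h'.2, smul_eq_mul,
      smul_eq_mul]
    ring⟩

theorem const_mul (c : ℝ) (h : HasDirDeriv f x u r) :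
    HasDirDeriv (fun y ↦ c * f y) x u (c * r) := by
  simpa using (const c x u).mul h

theorem sum {ι : Type*} {s : Finset ι} {f : ι → M → ℝ} {r : ι → ℝ}
    (h : ∀ i ∈ s, HasDirDeriv (f i) x u (r i)) :
    HasDirDeriv (fun y ↦ ∑ i ∈ s, f i y) x u (∑ i ∈ s, r i) := by
  classical
  induction s using Finset.induction_on with
  | empty => simpa using const 0 x u
  | insert i s hi ih =>
    simp only [Finset.sum_insert hi]
    exact (h i (by simp)).add (ih fun j hj ↦ h j (by simp [hj]))

end HasDirDeriv

variable [IsManifold 𝓘(ℝ, E) ∞ M]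

/-- The vector field `Y` is differentiable at `x`, and `∇_u Y = w`. -/
def HasCovDeriv (nabla : Connection E M) (Y : ∀ y : M, TangentSpace 𝓘(ℝ, E) y) (x : M)
    (u w : TangentSpace 𝓘(ℝ, E) x) : Prop :=
  VFDiffAt Y x ∧ nabla Y x u = w

namespace HasCovDeriv

variable {nabla : Connection E M} {Y Y' : ∀ y : M, TangentSpace 𝓘(ℝ, E) y} {x : M} {f : M → ℝ}
  {u w w' : TangentSpace 𝓘(ℝ, E) x} {r : ℝ}

theorem unique (h : HasCovDeriv nabla Y x u w) (h' : HasCovDeriv nabla Y x u w') : w = w' :=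
  h.2.symm.trans h'.2

theorem congr (h : HasCovDeriv nabla Y x u w) (hY : ∀ y, Y' y = Y y) :
    HasCovDeriv nabla Y' x u w := by
  rwa [show Y' = Y from funext hY]

theorem add [FiniteDimensional ℝ E] (h : HasCovDeriv nabla Y x u w)
    (h' : HasCovDeriv nabla Y' x u w') :
    HasCovDeriv nabla (fun y ↦ Y y + Y' y) x u (w + w') :=
  ⟨mdifferentiableAt_add_section h.1 h'.1,
    (congrArg (· u) (nabla.isCovariantDerivativeOn.add h.1 h'.1)).trans
      (congrArg₂ (· + ·) h.2 h'.2)⟩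

theorem smul [FiniteDimensional ℝ E] (hf : HasDirDeriv f x u r) (h : HasCovDeriv nabla Y x u w) :
    HasCovDeriv nabla (fun y ↦ f y • Y y) x u (f x • w + r • Y x) :=
  ⟨hf.1.smul_section h.1, by
    have := congrArg (· u) (nabla.isCovariantDerivativeOn.leibniz h.1 hf.1)
    refine this.trans ?_
    simp only [add_apply, smul_apply, ContinuousLinearMap.smulRight_apply]
    rw [h.2, hf.2]⟩

theorem neg [FiniteDimensional ℝ E] (h : HasCovDeriv nabla Y x u w) :
    HasCovDeriv nabla (fun y ↦ -Y y) x u (-w) := by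
  simpa using smul (.const (-1) x u) h

end HasCovDeriv

end DirectionalDerivatives

/-! ### Covariant derivatives of the structure tensors. -/

namespace AlmostThreeContactMetricStructure

section Derivatives

open Bundle

variable {E : Type*} [NormedAddCommGroup E] [NormedSpace ℝ E]
  {M : Type*} [TopologicalSpace M] [ChartedSpace E M] [IsManifold 𝓘(ℝ, E) ∞ M]
  (S : AlmostThreeContactMetricStructure E M)

theorem contMDiffAt_φ (i : Fin 3) {x : M} {Y : ∀ y : M, TangentSpace 𝓘(ℝ, E) y}
    (hY : ContMDiffAt 𝓘(ℝ, E) (𝓘(ℝ, E).prod 𝓘(ℝ, E)) ∞ (fun y ↦ TotalSpace.mk' E y (Y y)) x) :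
    ContMDiffAt 𝓘(ℝ, E) (𝓘(ℝ, E).prod 𝓘(ℝ, E)) ∞
      (fun y ↦ TotalSpace.mk' E y (S.φ i y (Y y))) x :=
  ((S.str i).smooth_φ x).clm_bundle_apply hY

theorem vFDiffAt_φ (i : Fin 3) {x : M} {Y : ∀ y : M, TangentSpace 𝓘(ℝ, E) y} (hY : VFDiffAt Y x) :
    VFDiffAt (fun y ↦ S.φ i y (Y y)) x :=
  (((S.str i).smooth_φ x).mdifferentiableAt (by simp)).clm_bundle_apply hY

theorem vFDiffAt_ξ (i : Fin 3) (x : M) : VFDiffAt (S.ξ i) x :=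
  ((S.str i).smooth_ξ x).mdifferentiableAt (by simp)

variable {S} in
theorem contMDiffAt_tangent_g {x : M} {V W : ∀ y : M, TangentSpace 𝓘(ℝ, E) y}
    (hV : ContMDiffAt 𝓘(ℝ, E) (𝓘(ℝ, E).prod 𝓘(ℝ, E)) ∞ (fun y ↦ TotalSpace.mk' E y (V y)) x)
    (hW : ContMDiffAt 𝓘(ℝ, E) (𝓘(ℝ, E).prod 𝓘(ℝ, E)) ∞ (fun y ↦ TotalSpace.mk' E y (W y)) x) :
    ContMDiffAt 𝓘(ℝ, E) 𝓘(ℝ, ℝ) ∞ (fun y ↦ (S.tangent y).g (V y) (W y)) x :=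
  contMDiffAt_inner S.g hV hW

theorem contMDiffAt_torsion (α δ : ℝ) {x : M} {U V W : ∀ y : M, TangentSpace 𝓘(ℝ, E) y}
    (hU : ContMDiffAt 𝓘(ℝ, E) (𝓘(ℝ, E).prod 𝓘(ℝ, E)) ∞ (fun y ↦ TotalSpace.mk' E y (U y)) x)
    (hV : ContMDiffAt 𝓘(ℝ, E) (𝓘(ℝ, E).prod 𝓘(ℝ, E)) ∞ (fun y ↦ TotalSpace.mk' E y (V y)) x)
    (hW : ContMDiffAt 𝓘(ℝ, E) (𝓘(ℝ, E).prod 𝓘(ℝ, E)) ∞ (fun y ↦ TotalSpace.mk' E y (W y)) x) :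
    ContMDiffAt 𝓘(ℝ, E) 𝓘(ℝ, ℝ) ∞ (fun y ↦ (S.tangent y).torsion α δ (U y) (V y) (W y)) x := by
  have hη (i : Fin 3) {V : ∀ y : M, TangentSpace 𝓘(ℝ, E) y}
      (hV : ContMDiffAt 𝓘(ℝ, E) (𝓘(ℝ, E).prod 𝓘(ℝ, E)) ∞ (fun y ↦ TotalSpace.mk' E y (V y)) x) :
      ContMDiffAt 𝓘(ℝ, E) 𝓘(ℝ, ℝ) ∞ (fun y ↦ (S.tangent y).g ((S.tangent y).ξ i) (V y)) x :=
    contMDiffAt_tangent_g ((S.str i).smooth_ξ x) hV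
  have hΦ (i : Fin 3) {V W : ∀ y : M, TangentSpace 𝓘(ℝ, E) y}
      (hV : ContMDiffAt 𝓘(ℝ, E) (𝓘(ℝ, E).prod 𝓘(ℝ, E)) ∞ (fun y ↦ TotalSpace.mk' E y (V y)) x)
      (hW : ContMDiffAt 𝓘(ℝ, E) (𝓘(ℝ, E).prod 𝓘(ℝ, E)) ∞ (fun y ↦ TotalSpace.mk' E y (W y)) x) :
      ContMDiffAt 𝓘(ℝ, E) 𝓘(ℝ, ℝ) ∞ (fun y ↦ (S.tangent y).g (V y) ((S.tangent y).φ i (W y))) x :=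
    contMDiffAt_tangent_g hV (S.contMDiffAt_φ i hW)
  refine ContMDiffAt.add (contMDiffAt_const.mul (contMDiffAt_finsetSum fun i _ ↦ ?_))
    (contMDiffAt_const.mul ?_)
  · exact (((hη i hU).mul (hΦ i hV hW)).sub ((hη i hV).mul (hΦ i hU hW))).add
      ((hη i hW).mul (hΦ i hU hV))
  · exact (((hη 0 hU).mul (((hη 1 hV).mul (hη 2 hW)).sub ((hη 1 hW).mul (hη 2 hV)))).sub
      ((hη 0 hV).mul (((hη 1 hU).mul (hη 2 hW)).sub ((hη 1 hW).mul (hη 2 hU))))).add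
      ((hη 0 hW).mul (((hη 1 hU).mul (hη 2 hV)).sub ((hη 1 hV).mul (hη 2 hU))))

theorem isSmoothAt_torsionForm (α δ : ℝ) (x : M) : (S.torsionForm α δ).IsSmoothAt x := fun v ↦ by
  simp only [torsionForm_apply]
  exact S.contMDiffAt_torsion α δ (contMDiffAt_coordField (mem_chart_source E x) _)
    (contMDiffAt_coordField (mem_chart_source E x) _)
    (contMDiffAt_coordField (mem_chart_source E x) _)

theorem isSmoothAt_ηForm (i : Fin 3) (x : M) : (S.ηForm i).IsSmoothAt x := fun v ↦ by
  simp only [ηForm_apply]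
  exact contMDiffAt_tangent_g ((S.str i).smooth_ξ x)
    (contMDiffAt_coordField (mem_chart_source E x) _)

variable {S} {α δ : ℝ}

theorem IsThreeSasaki.isSmoothAt_extD_ηForm (hS : S.IsThreeSasaki α δ) (i : Fin 3) (x : M) :
    (S.ηForm i).extD.IsSmoothAt x := fun v ↦ by
  simp only [hS.extD_ηForm_apply]
  have hv (j) := contMDiffAt_coordField (mem_chart_source E x) (v j)
  have hη (i : Fin 3) (j) : ContMDiffAt 𝓘(ℝ, E) 𝓘(ℝ, ℝ) ∞
      (fun y ↦ (S.tangent y).g ((S.tangent y).ξ i) (coordField x (v j) y)) x :=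
    contMDiffAt_tangent_g ((S.str i).smooth_ξ x) (hv j)
  exact (contMDiffAt_const.mul (contMDiffAt_tangent_g (hv 0) (S.contMDiffAt_φ i (hv 1)))).add
    (contMDiffAt_const.mul (((hη _ 0).mul (hη _ 1)).sub ((hη _ 1).mul (hη _ 0))))

variable [FiniteDimensional ℝ E] {nabla : Connection E M}
  {V W : ∀ y : M, TangentSpace 𝓘(ℝ, E) y} {x : M} {u v' w' : TangentSpace 𝓘(ℝ, E) x}

omit [FiniteDimensional ℝ E] in
theorem IsMetricConnection.hasDirDeriv (hm : S.IsMetricConnection nabla)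
    (hV : HasCovDeriv nabla V x u v') (hW : HasCovDeriv nabla W x u w') :
    HasDirDeriv (fun y ↦ (S.tangent y).g (V y) (W y)) x u
      ((S.tangent x).g v' (W x) + (S.tangent x).g (V x) w') :=
  ⟨mdifferentiableAt_inner S.g hV.1 hW.1, (hm x V W hV.1 hW.1 u).trans (by rw [hV.2, hW.2]; rfl)⟩

variable (S nabla)

omit [FiniteDimensional ℝ E] in
theorem tensorialAt_nablaφ (i : Fin 3) (x : M) : TensorialAt 𝓘(ℝ, E) E
    (fun Y ↦ nabla (fun y ↦ S.φ i y (Y y)) x - S.φ i x ∘L nabla Y x) x where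
  smul {f Y} hf hY := by
    have h1 := nabla.isCovariantDerivativeOn.leibniz (S.vFDiffAt_φ i hY) hf
    have h2 := nabla.isCovariantDerivativeOn.leibniz hY hf
    have h3 : (fun y ↦ S.φ i y ((f • Y) y)) = f • fun y ↦ S.φ i y (Y y) := by
      ext1 y; simp
    ext u
    rw [h3]
    refine (congrArg₂ (fun A B : TangentSpace 𝓘(ℝ, E) x →L[ℝ] TangentSpace 𝓘(ℝ, E) x ↦
      A u - S.φ i x (B u)) h1 h2).trans ?_
    simp [smul_sub]
  add {Y Y'} hY hY' := by
    have h1 := nabla.isCovariantDerivativeOn.add (S.vFDiffAt_φ i hY) (S.vFDiffAt_φ i hY')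
    have h2 := nabla.isCovariantDerivativeOn.add hY hY'
    have h3 : (fun y ↦ S.φ i y ((Y + Y') y)) =
        (fun y ↦ S.φ i y (Y y)) + fun y ↦ S.φ i y (Y' y) := by
      ext1 y; simp
    ext u
    rw [h3]
    refine (congrArg₂ (fun A B : TangentSpace 𝓘(ℝ, E) x →L[ℝ] TangentSpace 𝓘(ℝ, E) x ↦
      A u - S.φ i x (B u)) h1 h2).trans ?_
    simp
    abel

/-- The covariant derivative of `φ_i`; `nablaφ i x u v` is `(∇_u φ_i) v`. -/
noncomputable def nablaφ (i : Fin 3) (x : M) :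
    TangentSpace 𝓘(ℝ, E) x →ₗ[ℝ] TangentSpace 𝓘(ℝ, E) x →ₗ[ℝ] TangentSpace 𝓘(ℝ, E) x :=
  LinearMap.mk₂ ℝ (fun u v ↦ TensorialAt.mkHom _ x (S.tensorialAt_nablaφ nabla i x) v u)
    (by simp) (by simp) (by simp) (by simp)

/-- The covariant derivative of `ξ_i`. -/
noncomputable def nablaξ (i : Fin 3) (x : M) :
    TangentSpace 𝓘(ℝ, E) x →ₗ[ℝ] TangentSpace 𝓘(ℝ, E) x :=
  nabla (S.ξ i) x

variable {S nabla}

theorem nablaφ_apply (hV : VFDiffAt V x) (i : Fin 3) (u : TangentSpace 𝓘(ℝ, E) x) :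
    S.nablaφ nabla i x u (V x) = nabla (fun y ↦ S.φ i y (V y)) x u - S.φ i x (nabla V x u) :=
  congrArg (· u) (TensorialAt.mkHom_apply (S.tensorialAt_nablaφ nabla i x) hV)

variable (S) in
theorem _root_.HasCovDeriv.φ (hV : HasCovDeriv nabla V x u v') (i : Fin 3) :
    HasCovDeriv nabla (fun y ↦ (S.tangent y).φ i (V y)) x u
      (S.nablaφ nabla i x u (V x) + (S.tangent x).φ i v') := by
  refine ⟨S.vFDiffAt_φ i hV.1, ?_⟩
  rw [nablaφ_apply hV.1, hV.2]
  exact (sub_add_cancel _ _).symm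

omit [FiniteDimensional ℝ E] in
variable (S nabla) in
theorem hasCovDeriv_ξ (i : Fin 3) (x : M) (u : TangentSpace 𝓘(ℝ, E) x) :
    HasCovDeriv nabla (fun y ↦ (S.tangent y).ξ i) x u (S.nablaξ nabla i x u) :=
  ⟨S.vFDiffAt_ξ i x, rfl⟩

/-- Each identity is the covariant derivative along u of the corresponding defining identity,
evaluated on coordinate fields; the terms containing derivatives of the fields cancel. -/
theorem IsMetricConnection.isVariation (hm : S.IsMetricConnection nabla) (x : M)
    (u : TangentSpace 𝓘(ℝ, E) x) :
    (S.tangent x).IsVariation (S.nablaφ nabla · x u) (S.nablaξ nabla · x u) := by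
  have hc (v : TangentSpace 𝓘(ℝ, E) x) : HasCovDeriv nabla (coordField x v) x u _ :=
    ⟨mdifferentiableAt_coordField x v, rfl⟩
  have hξ (i) := S.hasCovDeriv_ξ nabla i x u
  have hη (i) (v : TangentSpace 𝓘(ℝ, E) x) := hm.hasDirDeriv (hξ i) (hc v)
  have e (v : TangentSpace 𝓘(ℝ, E) x) := coordField_self x v
  constructor
  · intro i v w
    have h1 := hm.hasDirDeriv ((hc v).φ S i) (hc w)
    have h2 := (hm.hasDirDeriv (hc v) ((hc w).φ S i)).neg
    have h3 := h1.unique (h2.congr fun y ↦ (S.tangent y).φ_skew i _ _)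
    simp only [coordField_self, map_add, LinearMap.add_apply, ThreeContactSpace.φ_skew] at h3
    linear_combination h3
  · intro i j
    have h1 := hm.hasDirDeriv (hξ i) (hξ j)
    have h2 := h1.unique ((HasDirDeriv.const _ x u).congr fun y ↦ (S.tangent y).g_ξ i j)
    rw [(S.tangent x).g_symm _ ((S.tangent x).ξ i)]
    exact h2
  · intro i v
    have h1 := (((hc v).φ S i).φ S i).unique
      (((hc v).neg.add (HasCovDeriv.smul (hη i v) (hξ i))).congr fun y ↦ (S.tangent y).φ_φ_self i _)
    simp only [coordField_self, map_add, ThreeContactSpace.φ_φ_self] at h1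
    linear_combination (norm := module) h1
  · intro i v
    have h1 := (((hc v).φ S (i + 1)).φ S i).unique
      ((((hc v).φ S (i + 2)).add (HasCovDeriv.smul (hη (i + 1) v) (hξ i))).congr
        fun y ↦ (S.tangent y).φ_φ_succ i _)
    simp only [coordField_self, map_add, ThreeContactSpace.φ_φ_succ] at h1
    linear_combination (norm := module) h1
  · intro i v
    have h1 := (((hc v).φ S i).φ S (i + 1)).unique
      ((((hc v).φ S (i + 2)).neg.add (HasCovDeriv.smul (hη i v) (hξ (i + 1)))).congr
        fun y ↦ (S.tangent y).φ_succ_φ i _)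
    simp only [coordField_self, map_add, ThreeContactSpace.φ_succ_φ] at h1
    linear_combination (norm := module) h1
  · intro i
    have h0 := HasCovDeriv.smul (.const 0 x u) (hξ i)
    simp only [zero_smul, add_zero] at h0
    exact ((hξ i).φ S i).unique (h0.congr fun y ↦ (S.tangent y).φ_ξ_self i)
  · intro i
    exact ((hξ (i + 1)).φ S i).unique ((hξ (i + 2)).congr fun y ↦ (S.tangent y).φ_ξ_succ i)
  · intro i
    exact ((hξ i).φ S (i + 1)).unique ((hξ (i + 2)).neg.congr fun y ↦ (S.tangent y).φ_succ_ξ i)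

end Derivatives

end AlmostThreeContactMetricStructure

/-! ### The structure equation and its derivative at a point. -/

namespace AlmostThreeContactMetricStructure

section SasakiJet

open Bundle VectorField

variable {E : Type*} [NormedAddCommGroup E] [NormedSpace ℝ E] [FiniteDimensional ℝ E]
  {M : Type*} [TopologicalSpace M] [ChartedSpace E M] [IsManifold 𝓘(ℝ, E) ∞ M]
  {S : AlmostThreeContactMetricStructure E M} {α δ : ℝ} {nabla : Connection E M}

omit [FiniteDimensional ℝ E] in
theorem hasDirDeriv_removeNth {k : ℕ} {a : DiffForm E M k} {x : M} {u : TangentSpace 𝓘(ℝ, E) x}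
    {v : Fin (k + 1) → TangentSpace 𝓘(ℝ, E) x} {Y : Fin k → ∀ y : M, TangentSpace 𝓘(ℝ, E) y}
    {r : ℝ} (h : HasDirDeriv (fun y ↦ a y (fun l ↦ Y l y)) x u r) (j : Fin (k + 1))
    (hY : ∀ l, Y l = coordField x (j.removeNth v l)) :
    mvfderiv 𝓘(ℝ, E) (fun y ↦ a y (fun l ↦ coordField x (j.removeNth v l) y)) x u = r := by
  simp only [← hY]
  exact h.2

theorem _root_.DiffForm.IsSmoothAt.extD_apply_one {a : DiffForm E M 1} {x : M} (ha : a.IsSmoothAt x)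
    {u v : TangentSpace 𝓘(ℝ, E) x} {r₀ r₁ : ℝ}
    (h₀ : HasDirDeriv (fun y ↦ a y (fun l ↦ ![coordField x v] l y)) x u r₀)
    (h₁ : HasDirDeriv (fun y ↦ a y (fun l ↦ ![coordField x u] l y)) x v r₁) :
    a.extD x ![u, v] = r₀ - r₁ := by
  refine (ha.extD_apply _).trans ((Fin.sum_univ_two _).trans ?_)
  have e₀ := hasDirDeriv_removeNth (v := ![u, v]) h₀ 0 (fun l ↦ by fin_cases l; rfl)
  have e₁ := hasDirDeriv_removeNth (v := ![u, v]) h₁ 1 (fun l ↦ by fin_cases l; rfl)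
  refine (congrArg₂ (fun p q ↦ (-1) ^ 0 * p + (-1) ^ 1 * q) e₀ e₁).trans ?_
  ring

theorem _root_.DiffForm.IsSmoothAt.extD_apply_two {a : DiffForm E M 2} {x : M} (ha : a.IsSmoothAt x)
    {u v w : TangentSpace 𝓘(ℝ, E) x} {r₀ r₁ r₂ : ℝ}
    (h₀ : HasDirDeriv (fun y ↦ a y (fun l ↦ ![coordField x v, coordField x w] l y)) x u r₀)
    (h₁ : HasDirDeriv (fun y ↦ a y (fun l ↦ ![coordField x u, coordField x w] l y)) x v r₁)
    (h₂ : HasDirDeriv (fun y ↦ a y (fun l ↦ ![coordField x u, coordField x v] l y)) x w r₂) :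
    a.extD x ![u, v, w] = r₀ - r₁ + r₂ := by
  refine (ha.extD_apply _).trans ((Fin.sum_univ_three _).trans ?_)
  have e₀ := hasDirDeriv_removeNth (v := ![u, v, w]) h₀ 0 (fun l ↦ by fin_cases l <;> rfl)
  have e₁ := hasDirDeriv_removeNth (v := ![u, v, w]) h₁ 1 (fun l ↦ by fin_cases l <;> rfl)
  have e₂ := hasDirDeriv_removeNth (v := ![u, v, w]) h₂ 2 (fun l ↦ by fin_cases l <;> rfl)
  refine (congrArg₂ (fun p q ↦ (-1) ^ 0 * p + (-1) ^ 1 * q + _) e₀ e₁).trans ?_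
  refine (congrArg (fun p ↦ (-1) ^ 0 * r₀ + (-1) ^ 1 * r₁ + (-1) ^ 2 * p) e₂).trans ?_
  ring

theorem _root_.DiffForm.IsSmoothAt.extD_apply_three {a : DiffForm E M 3} {x : M}
    (ha : a.IsSmoothAt x) {u v w z : TangentSpace 𝓘(ℝ, E) x} {r₀ r₁ r₂ r₃ : ℝ}
    (h₀ : HasDirDeriv (fun y ↦ a y (fun l ↦ ![coordField x v, coordField x w, coordField x z] l y))
      x u r₀)
    (h₁ : HasDirDeriv (fun y ↦ a y (fun l ↦ ![coordField x u, coordField x w, coordField x z] l y))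
      x v r₁)
    (h₂ : HasDirDeriv (fun y ↦ a y (fun l ↦ ![coordField x u, coordField x v, coordField x z] l y))
      x w r₂)
    (h₃ : HasDirDeriv (fun y ↦ a y (fun l ↦ ![coordField x u, coordField x v, coordField x w] l y))
      x z r₃) :
    a.extD x ![u, v, w, z] = r₀ - r₁ + r₂ - r₃ := by
  refine (ha.extD_apply _).trans ((Fin.sum_univ_four _).trans ?_)
  have e₀ := hasDirDeriv_removeNth (v := ![u, v, w, z]) h₀ 0 (fun l ↦ by fin_cases l <;> rfl)
  have e₁ := hasDirDeriv_removeNth (v := ![u, v, w, z]) h₁ 1 (fun l ↦ by fin_cases l <;> rfl)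
  have e₂ := hasDirDeriv_removeNth (v := ![u, v, w, z]) h₂ 2 (fun l ↦ by fin_cases l <;> rfl)
  have e₃ := hasDirDeriv_removeNth (v := ![u, v, w, z]) h₃ 3 (fun l ↦ by fin_cases l <;> rfl)
  refine (congrArg₂ (fun p q ↦ (-1) ^ 0 * p + (-1) ^ 1 * q + _ + _) e₀ e₁).trans ?_
  refine (congrArg₂ (fun p q ↦ (-1) ^ 0 * r₀ + (-1) ^ 1 * r₁ + (-1) ^ 2 * p + (-1) ^ 3 * q)
    e₂ e₃).trans ?_
  ring

theorem IsThreeSasaki.isSasakiJet (hS : S.IsThreeSasaki α δ) (hm : S.IsMetricConnection nabla)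
    (ht : S.IsTorsionForm nabla (S.torsionForm α δ)) (x : M) :
    (S.tangent x).IsSasakiJet α δ (S.nablaφ nabla · x) (S.nablaξ nabla · x)
      (fun u v ↦ nabla (coordField x v) x u) := by
  have hc (u v : TangentSpace 𝓘(ℝ, E) x) : HasCovDeriv nabla (coordField x v) x u _ :=
    ⟨mdifferentiableAt_coordField x v, rfl⟩
  have hη (i u v) := hm.hasDirDeriv (S.hasCovDeriv_ξ nabla i x u) (hc u v)
  refine ⟨hm.isVariation x, fun u v w ↦ ?_, fun i u v ↦ ?_, fun i u v w ↦ ?_⟩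
  · have h1 := ht x u v w
    rw [torsionForm_apply] at h1
    refine Eq.trans ?_ h1.symm
    have h2 := CovariantDerivative.torsion_apply nabla (mdifferentiableAt_coordField x u)
      (mdifferentiableAt_coordField x v)
    rw [mlieBracket_coordField, sub_zero, coordField_self, coordField_self] at h2
    rw [h2]
    rfl
  · have hη' (u v) := (hη i u v).congr
      fun y ↦ S.ηForm_apply i y (fun l ↦ ![coordField x v] l y)
    have h1 := (S.isSmoothAt_ηForm i x).extD_apply_one (hη' u v) (hη' v u)
    rw [hS.extD_ηForm_apply] at h1
    simp only [coordField_self] at h1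
    exact h1.symm
  · have h1 (u v w : TangentSpace 𝓘(ℝ, E) x) :=
      (((hm.hasDirDeriv (hc u v) ((hc u w).φ S i)).const_mul (2 * α)).add
        ((((hη (i + 1) u v).mul (hη (i + 2) u w)).sub
          ((hη (i + 1) u w).mul (hη (i + 2) u v))).const_mul (2 * (α - δ)))).congr
        fun y ↦ hS.extD_ηForm_apply i y (fun l ↦ ![coordField x v, coordField x w] l y)
    -- The middle term of the exterior derivative has arguments (u, w); reversing them absorbs its
    -- sign and makes the sum cyclic.
    have h2 := (hS.isSmoothAt_extD_ηForm i x).extD_apply_two (h1 u v w)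
      ((h1 v w u).neg.congr fun y ↦ by
        rw [hS.extD_ηForm_apply, hS.extD_ηForm_apply, (S.tangent y).g_φ_left]
        simp only [Matrix.cons_val_zero, Matrix.cons_val_one]
        ring) (h1 w u v)
    have h3 := congrArg (· ![u, v, w]) (DiffForm.extD_extD (S.isSmoothAt_ηForm i x))
    replace h2 := h2.symm.trans h3
    simp only [coordField_self] at h2
    simp only
    refine Eq.trans ?_ h2
    ring

end SasakiJet

end AlmostThreeContactMetricStructure

/-! ### Parallelism of the torsion and its exterior derivative. -/

namespace AlmostThreeContactMetricStructure

section Parallel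

open Bundle VectorField

variable {E : Type*} [NormedAddCommGroup E] [NormedSpace ℝ E] [FiniteDimensional ℝ E]
  {M : Type*} [TopologicalSpace M] [ChartedSpace E M] [IsManifold 𝓘(ℝ, E) ∞ M]
  {S : AlmostThreeContactMetricStructure E M} {α δ : ℝ} {nabla : Connection E M}

/-- ∑ η_i ∧ Φ_i and η_123 are SO(3)-invariant, so the terms from rotating the triple cancel,
whatever the angular velocity `a`, and only the arguments are differentiated. -/
theorem IsMetricConnection.hasDirDeriv_torsion (hm : S.IsMetricConnection nabla) {x : M}
    {u : TangentSpace 𝓘(ℝ, E) x} {a : Fin 3 → ℝ}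
    (hφ : ∀ i, S.nablaφ nabla i x u = (S.tangent x).rotφ a i)
    (hξ : ∀ i, S.nablaξ nabla i x u = (S.tangent x).rotξ a i) (α δ : ℝ)
    {U V W : ∀ y : M, TangentSpace 𝓘(ℝ, E) y} {u' v' w' : TangentSpace 𝓘(ℝ, E) x}
    (hU : HasCovDeriv nabla U x u u') (hV : HasCovDeriv nabla V x u v')
    (hW : HasCovDeriv nabla W x u w') :
    HasDirDeriv (fun y ↦ (S.tangent y).torsion α δ (U y) (V y) (W y)) x u
      ((S.tangent x).torsion α δ u' (V x) (W x) + (S.tangent x).torsion α δ (U x) v' (W x)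
        + (S.tangent x).torsion α δ (U x) (V x) w') := by
  have hη (i) {V : ∀ y : M, TangentSpace 𝓘(ℝ, E) y} {v' : TangentSpace 𝓘(ℝ, E) x}
      (hV : HasCovDeriv nabla V x u v') := hm.hasDirDeriv (S.hasCovDeriv_ξ nabla i x u) hV
  have hΦ (i) {V W : ∀ y : M, TangentSpace 𝓘(ℝ, E) y} {v' w' : TangentSpace 𝓘(ℝ, E) x}
      (hV : HasCovDeriv nabla V x u v') (hW : HasCovDeriv nabla W x u w') :=
    hm.hasDirDeriv hV (hW.φ S i)
  simp only [hφ, hξ] at hη hΦ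
  have h1 := (HasDirDeriv.sum (s := Finset.univ) fun (r : Fin 3) _ ↦
      (((hη r hU).mul (hΦ r hV hW)).sub ((hη r hV).mul (hΦ r hU hW))).add
      ((hη r hW).mul (hΦ r hU hV))).const_mul (2 * α)
  have h2 := ((((hη 0 hU).mul (((hη 1 hV).mul (hη 2 hW)).sub ((hη 1 hW).mul (hη 2 hV)))).sub
      ((hη 0 hV).mul (((hη 1 hU).mul (hη 2 hW)).sub ((hη 1 hW).mul (hη 2 hU))))).add
      ((hη 0 hW).mul (((hη 1 hU).mul (hη 2 hV)).sub ((hη 1 hV).mul (hη 2 hU))))).const_mul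
      (2 * (δ - α))
  have h3 := h1.add h2
  refine ⟨h3.1, h3.2.trans ?_⟩
  generalize S.tangent x = L
  simp [ThreeContactSpace.torsion, ThreeContactSpace.vol, ThreeContactSpace.rotφ,
    ThreeContactSpace.rotξ, Fin.sum_univ_three]
  ring

theorem IsThreeSasaki.nablaφ_eq (hS : S.IsThreeSasaki α δ) (hm : S.IsMetricConnection nabla)
    (ht : S.IsTorsionForm nabla (S.torsionForm α δ)) (i : Fin 3) (x : M)
    (u : TangentSpace 𝓘(ℝ, E) x) : S.nablaφ nabla i x u = (S.tangent x).rotφ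
      (fun r ↦ 2 * (δ - 2 * α) * (S.tangent x).g ((S.tangent x).ξ r) u) i :=
  ((hS.isSasakiJet hm ht x).eq_rot hS.α_ne_zero i u).1

theorem IsThreeSasaki.nablaξ_eq (hS : S.IsThreeSasaki α δ) (hm : S.IsMetricConnection nabla)
    (ht : S.IsTorsionForm nabla (S.torsionForm α δ)) (i : Fin 3) (x : M)
    (u : TangentSpace 𝓘(ℝ, E) x) : S.nablaξ nabla i x u = (S.tangent x).rotξ
      (fun r ↦ 2 * (δ - 2 * α) * (S.tangent x).g ((S.tangent x).ξ r) u) i :=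
  ((hS.isSasakiJet hm ht x).eq_rot hS.α_ne_zero i u).2

theorem IsThreeSasaki.hasDirDeriv_torsion (hS : S.IsThreeSasaki α δ)
    (hm : S.IsMetricConnection nabla) (ht : S.IsTorsionForm nabla (S.torsionForm α δ)) {x : M}
    {u : TangentSpace 𝓘(ℝ, E) x} {U V W : ∀ y : M, TangentSpace 𝓘(ℝ, E) y}
    {u' v' w' : TangentSpace 𝓘(ℝ, E) x} (hU : HasCovDeriv nabla U x u u')
    (hV : HasCovDeriv nabla V x u v') (hW : HasCovDeriv nabla W x u w') :
    HasDirDeriv (fun y ↦ (S.tangent y).torsion α δ (U y) (V y) (W y)) x u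
      ((S.tangent x).torsion α δ u' (V x) (W x) + (S.tangent x).torsion α δ (U x) v' (W x)
        + (S.tangent x).torsion α δ (U x) (V x) w') :=
  hm.hasDirDeriv_torsion (fun i ↦ hS.nablaφ_eq hm ht i x u) (fun i ↦ hS.nablaξ_eq hm ht i x u)
    α δ hU hV hW

theorem IsThreeSasaki.isParallel_torsionForm (hS : S.IsThreeSasaki α δ)
    (hm : S.IsMetricConnection nabla) (ht : S.IsTorsionForm nabla (S.torsionForm α δ)) :
    (S.torsionForm α δ).IsParallel nabla := by
  intro x Y hY
  have h (v : TangentSpace 𝓘(ℝ, E) x) := hS.hasDirDeriv_torsion hm ht (u := v)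
    ⟨hY 0, rfl⟩ ⟨hY 1, rfl⟩ ⟨hY 2, rfl⟩
  simp only [torsionForm_apply, Fin.sum_univ_three]
  exact ⟨(h 0).1, fun v ↦ (h v).2⟩

/-- As T is parallel, dT on coordinate fields is an alternating sum of twelve terms with one
argument ∇_p Y_q; they pair into six terms T(T(p, q), ·, ·). -/
theorem IsThreeSasaki.extD_torsionForm_apply (hS : S.IsThreeSasaki α δ)
    (hm : S.IsMetricConnection nabla) (ht : S.IsTorsionForm nabla (S.torsionForm α δ)) (x : M)
    (u v w z : TangentSpace 𝓘(ℝ, E) x) : (fun L : ThreeContactSpace (TangentSpace 𝓘(ℝ, E) x) ↦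
    (S.torsionForm α δ).extD x ![u, v, w, z] =
    8 * α ^ 2 * ∑ r, (L.g u (L.φ r v) * L.g w (L.φ r z) - L.g u (L.φ r w) * L.g v (L.φ r z)
      + L.g u (L.φ r z) * L.g v (L.φ r w))
    + 8 * α * (δ - α) * ∑ r : Fin 3, (fun b : TangentSpace 𝓘(ℝ, E) x → TangentSpace 𝓘(ℝ, E) x → ℝ ↦
        L.g u (L.φ r v) * b w z - L.g u (L.φ r w) * b v z + L.g u (L.φ r z) * b v w
        + L.g v (L.φ r w) * b u z - L.g v (L.φ r z) * b u w + L.g w (L.φ r z) * b u v) (fun p q ↦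
        L.g (L.ξ (r + 1)) p * L.g (L.ξ (r + 2)) q - L.g (L.ξ (r + 1)) q * L.g (L.ξ (r + 2)) p))
      (S.tangent x) := by
  have hc (u v : TangentSpace 𝓘(ℝ, E) x) : HasCovDeriv nabla (coordField x v) x u _ :=
    ⟨mdifferentiableAt_coordField x v, rfl⟩
  have h (u v w z : TangentSpace 𝓘(ℝ, E) x) :=
    (hS.hasDirDeriv_torsion hm ht (hc u v) (hc u w) (hc u z)).congr fun y ↦
      S.torsionForm_apply α δ y (fun l ↦ ![coordField x v, coordField x w, coordField x z] l y)
  have h1 := (S.isSmoothAt_torsionForm α δ x).extD_apply_three (h u v w z) (h v u w z) (h w u v z)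
    (h z u v w)
  refine h1.trans (Eq.trans ?_ ((S.tangent x).sum_torsion_torsion α δ
    (hS.isSasakiJet hm ht x).torsion u v w z))
  have hτ := (S.tangent x).isSkewTrilinear_torsion α δ
  have hsub (a b p q : TangentSpace 𝓘(ℝ, E) x) : (S.tangent x).torsion α δ (a - b) p q =
      (S.tangent x).torsion α δ a p q - (S.tangent x).torsion α δ b p q := by
    rw [eq_sub_iff_add_eq, ← hτ.add_left, sub_add_cancel]
  have hmid (a b p : TangentSpace 𝓘(ℝ, E) x) : (S.tangent x).torsion α δ p a b =
      -(S.tangent x).torsion α δ a p b := hτ.swap_left a p b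
  have hright (a p q : TangentSpace 𝓘(ℝ, E) x) : (S.tangent x).torsion α δ p q a =
      (S.tangent x).torsion α δ a p q := by
    rw [hτ.swap_right, hmid, neg_neg]
  simp only [coordField_self, hsub]
  simp only [hmid (nabla _ _ _), hright (nabla _ _ _)]
  ring

end Parallel

end AlmostThreeContactMetricStructure

theorem ContinuousAlternatingMap.swap_three {V : Type*} [AddCommGroup V] [Module ℝ V]
    [TopologicalSpace V] (a : V [⋀^Fin 3]→L[ℝ] ℝ) (u v w : V) :
    a ![u, w, v] = -a ![u, v, w] := by
  have h := a.toAlternatingMap.map_swap ![u, v, w] (i := 1) (j := 2) (by decide)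
  rwa [show ![u, v, w] ∘ Equiv.swap 1 2 = ![u, w, v] by ext i; fin_cases i <;> rfl] at h

/-! ### Existence, uniqueness and the global formulas. -/

namespace AlmostThreeContactMetricStructure

section CanonicalConnection

open Bundle VectorField

variable {E : Type*} [NormedAddCommGroup E] [NormedSpace ℝ E] [FiniteDimensional ℝ E]
  {M : Type*} [TopologicalSpace M] [ChartedSpace E M] [IsManifold 𝓘(ℝ, E) ∞ M]
  {S : AlmostThreeContactMetricStructure E M} {α δ : ℝ} {nabla nabla' : Connection E M}

theorem HasSkewTorsion.inner_torsion_swap (h : S.HasSkewTorsion nabla) {x : M}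
    (u v w : TangentSpace 𝓘(ℝ, E) x) :
    S.g.inner x (nabla.torsion x u v) w = -S.g.inner x (nabla.torsion x u w) v := by
  obtain ⟨T, hT⟩ := h
  rw [← hT, ← hT]
  exact ContinuousAlternatingMap.swap_three _ u w v

theorem torsion_eq_sub {x : M} (u v : TangentSpace 𝓘(ℝ, E) x) :
    nabla.torsion x u v = nabla (coordField x v) x u - nabla (coordField x u) x v := by
  have h := CovariantDerivative.torsion_apply nabla (mdifferentiableAt_coordField x u)
      (mdifferentiableAt_coordField x v)
  rwa [mlieBracket_coordField, sub_zero, coordField_self, coordField_self] at h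

theorem exists_horizontal_ne_zero (hdim : 3 < Module.finrank ℝ E) (x : M) :
    ∃ y ≠ 0, ∀ r, (S.tangent x).g ((S.tangent x).ξ r) y = 0 := by
  let f : E →ₗ[ℝ] Fin 3 → ℝ := LinearMap.pi fun r ↦ (S.tangent x).g ((S.tangent x).ξ r)
  have h := LinearMap.ker_ne_bot_of_finrank_lt (f := f) (by simpa using hdim)
  obtain ⟨y, hy, hy0⟩ := Submodule.exists_mem_ne_zero_of_ne_bot h
  exact ⟨y, hy0, fun r ↦ congrFun (LinearMap.mem_ker.1 hy) r⟩

/-- The difference of two connections is a tensor, and all conditions pass to it: it is metric, has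
skew antisymmetrisation, and rotates the φ_i with coefficient β' - β, so `difference_eq_zero`
applies. -/
theorem IsCanonicalConnection.unique (hdim : 3 < Module.finrank ℝ E)
    (h : S.IsCanonicalConnection nabla) (h' : S.IsCanonicalConnection nabla')
    {Y : ∀ y : M, TangentSpace 𝓘(ℝ, E) y} {x : M} (hY : VFDiffAt Y x) : nabla' Y x = nabla Y x := by
  obtain ⟨β, -, hβ⟩ := h.nabla_φ
  obtain ⟨β', -, hβ'⟩ := h'.nabla_φ
  let A := IsCovariantDerivativeOn.difference nabla'.isCovariantDerivativeOn
    nabla.isCovariantDerivativeOn (s := Set.univ) x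
  have hA {Y : ∀ y : M, TangentSpace 𝓘(ℝ, E) y} (hY : VFDiffAt Y x) (u : TangentSpace 𝓘(ℝ, E) x) :
      A (Y x) u = nabla' Y x u - nabla Y x u :=
    congrArg (· u) (IsCovariantDerivativeOn.difference_apply
      nabla'.isCovariantDerivativeOn nabla.isCovariantDerivativeOn (Set.mem_univ x) hY)
  let D : TangentSpace 𝓘(ℝ, E) x →ₗ[ℝ] TangentSpace 𝓘(ℝ, E) x →ₗ[ℝ] TangentSpace 𝓘(ℝ, E) x :=
    LinearMap.mk₂ ℝ (fun u v ↦ A v u) (by simp) (by simp) (by simp) (by simp)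
  have hD (u v : TangentSpace 𝓘(ℝ, E) x) :
      D u v = nabla' (coordField x v) x u - nabla (coordField x v) x u := by
    rw [← hA (mdifferentiableAt_coordField x v), coordField_self]
    rfl
  have hT (u v : TangentSpace 𝓘(ℝ, E) x) :
      D u v - D v u = nabla'.torsion x u v - nabla.torsion x u v := by
    rw [hD, hD, torsion_eq_sub, torsion_eq_sub]
    abel
  have key : D = 0 := by
    refine (S.tangent x).difference_eq_zero (exists_horizontal_ne_zero hdim x) D ?_ ?_
      (β' x - β x) ?_
    · intro u v w
      have h1 := h.metric x _ _ (mdifferentiableAt_coordField x v)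
        (mdifferentiableAt_coordField x w) u
      have h2 := h'.metric x _ _ (mdifferentiableAt_coordField x v)
        (mdifferentiableAt_coordField x w) u
      have h3 := h1.symm.trans h2
      simp only [coordField_self] at h3
      simp only [hD, map_sub, LinearMap.sub_apply, tangent_g]
      linear_combination -h3
    · intro u v w
      have h1 := h.skew.inner_torsion_swap u v w
      have h2 := h'.skew.inner_torsion_swap u v w
      simp only [hT, map_sub, LinearMap.sub_apply, tangent_g]
      linear_combination h2 - h1
    · intro i u v
      have hv := mdifferentiableAt_coordField x v
      have h1 := hβ i x _ hv u
      have h2 := hβ' i x _ hv u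
      have h3 := hA (S.vFDiffAt_φ i hv) u
      simp only [coordField_self, η_eq_tangent] at h1 h2 h3
      have h4 : D u ((S.tangent x).φ i v) = A (S.φ i x v) u := rfl
      rw [h4, h3, hD, map_sub]
      simp only [tangent_φ] at *
      linear_combination (norm := module) h2 - h1
  ext u
  have := (hA hY u).symm.trans (congrArg (fun D : TangentSpace 𝓘(ℝ, E) x →ₗ[ℝ]
    TangentSpace 𝓘(ℝ, E) x →ₗ[ℝ] TangentSpace 𝓘(ℝ, E) x ↦ D u (Y x)) key)
  exact sub_eq_zero.1 this

variable (S α δ) in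
/-- The canonical connection. -/
noncomputable def canonicalConnection : Connection E M :=
  koszulConnection S.g (τ := fun x ↦ (S.tangent x).torsion α δ)
    fun x ↦ (S.tangent x).isSkewTrilinear_torsion α δ

theorem isMetricConnection_canonicalConnection :
    S.IsMetricConnection (S.canonicalConnection α δ) := fun _ _ _ hV hW u ↦
  koszulConnection_metric S.g _ hV hW u

theorem isTorsionForm_canonicalConnection :
    S.IsTorsionForm (S.canonicalConnection α δ) (S.torsionForm α δ) := fun x u v w ↦
  (S.torsionForm_apply α δ x _).trans (koszulConnection_torsion S.g
    (τ := fun x ↦ (S.tangent x).torsion α δ) _ u v w).symm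

theorem IsThreeSasaki.isCanonicalConnection (hS : S.IsThreeSasaki α δ) :
    S.IsCanonicalConnection (S.canonicalConnection α δ) where
  smooth := contMDiff_koszulConnection S.g _ fun _ _ _ _ ↦ S.contMDiffAt_torsion α δ
  metric := isMetricConnection_canonicalConnection
  skew := ⟨_, isTorsionForm_canonicalConnection⟩
  nabla_φ := by
    refine ⟨fun _ ↦ 2 * (δ - 2 * α), contMDiff_const, fun i x Y hY u ↦ ?_⟩
    rw [← nablaφ_apply hY, hS.nablaφ_eq isMetricConnection_canonicalConnection
      isTorsionForm_canonicalConnection, η_eq_tangent, η_eq_tangent]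
    simp only [ThreeContactSpace.rotφ, LinearMap.sub_apply, LinearMap.smul_apply, smul_sub,
      smul_smul]
    rfl

theorem IsThreeSasaki.extD_torsionForm (hS : S.IsThreeSasaki α δ) :
    (S.torsionForm α δ).extD = (4 * α ^ 2) • ∑ i, (S.Φ i).wedge (S.Φ i) +
      (8 * α * (δ - α)) • ∑ i, (S.Φ i).wedge (S.η₂ (i + 1) (i + 2)) := by
  funext x
  ext v
  have h (i : Fin 3) : (S.Φ i).wedge (S.Φ i) x v = _ := altWedge_two_two _ _ v
  have h' (i : Fin 3) : (S.Φ i).wedge (S.η₂ (i + 1) (i + 2)) x v = _ := altWedge_two_two _ _ v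
  have e : ((4 * α ^ 2) • ∑ i, (S.Φ i).wedge (S.Φ i) + (8 * α * (δ - α)) •
      ∑ i, (S.Φ i).wedge (S.η₂ (i + 1) (i + 2)) : DiffForm E M 4) x v =
      4 * α ^ 2 * ∑ i, (S.Φ i).wedge (S.Φ i) x v
        + 8 * α * (δ - α) * ∑ i, (S.Φ i).wedge (S.η₂ (i + 1) (i + 2)) x v := by
    simp
  have hv : v = ![v 0, v 1, v 2, v 3] := by ext j; fin_cases j <;> rfl
  refine Eq.trans ?_ e.symm
  rw [hv]
  refine (hS.extD_torsionForm_apply isMetricConnection_canonicalConnection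
    isTorsionForm_canonicalConnection x (v 0) (v 1) (v 2) (v 3)).trans ?_
  rw [← hv]
  simp only [h, h', Φ_apply, η₂_apply, Fin.sum_univ_three, Matrix.cons_val_zero,
    Matrix.cons_val_one]
  ring

/-- The identity holds for each i separately. Since Φ_i = Φ_i^H - η_{jk} and η_{jk} ∧ η_{jk} = 0,
Φ_i ∧ Φ_i contributes -2 Φ_i^H ∧ η_{jk}, and 8α(δ - α) - 8α² = 8α(δ - 2α). -/
theorem IsThreeSasaki.extD_torsionForm' (hS : S.IsThreeSasaki α δ) :
    (S.torsionForm α δ).extD = (4 * α ^ 2) • ∑ i, (S.ΦH i).wedge (S.ΦH i) +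
      (8 * α * (δ - 2 * α)) • ∑ i, (S.ΦH i).wedge (S.η₂ (i + 1) (i + 2)) := by
  rw [hS.extD_torsionForm]
  funext x
  ext v
  have h (i : Fin 3) : (S.Φ i).wedge (S.Φ i) x v = _ := altWedge_two_two _ _ v
  have h' (i : Fin 3) : (S.Φ i).wedge (S.η₂ (i + 1) (i + 2)) x v = _ := altWedge_two_two _ _ v
  have k (i : Fin 3) : (S.ΦH i).wedge (S.ΦH i) x v = _ := altWedge_two_two _ _ v
  have k' (i : Fin 3) : (S.ΦH i).wedge (S.η₂ (i + 1) (i + 2)) x v = _ := altWedge_two_two _ _ v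
  have e (a b : ℝ) (p q : Fin 3 → DiffForm E M 4) : (a • ∑ i, p i + b • ∑ i, q i) x v =
      a * ∑ i, p i x v + b * ∑ i, q i x v := by
    simp
  refine (e _ _ _ _).trans (Eq.trans ?_ (e _ _ _ _).symm)
  rw [Finset.mul_sum, Finset.mul_sum, Finset.mul_sum, Finset.mul_sum, ← Finset.sum_add_distrib,
    ← Finset.sum_add_distrib]
  refine Finset.sum_congr rfl fun i _ ↦ ?_
  rw [h, h', k, k']
  simp only [Φ_apply, ΦH_apply, η₂_apply, Matrix.cons_val_zero, Matrix.cons_val_one]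
  ring

end CanonicalConnection

end AlmostThreeContactMetricStructure

theorem mainTheorem3 {E : Type*} [NormedAddCommGroup E] [NormedSpace ℝ E] [FiniteDimensional ℝ E]
    {M : Type*} [TopologicalSpace M] [T2Space M] [SecondCountableTopology M] [ChartedSpace E M]
    [IsManifold 𝓘(ℝ, E) ∞ M] (n : ℕ) (hn : 1 ≤ n) (hdim : Module.finrank ℝ E = 4 * n + 3)
    (S : AlmostThreeContactMetricStructure E M) (α δ : ℝ) (hS : S.IsThreeSasaki α δ) :
    ∃ nabla : Connection E M, S.IsCanonicalConnection nabla ∧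
      (∀ nabla' : Connection E M, S.IsCanonicalConnection nabla' →
        ∀ (Y : ∀ y : M, TangentSpace 𝓘(ℝ, E) y) (x : M), VFDiffAt Y x →
          nabla' Y x = nabla Y x) ∧
      ∃ T : DiffForm E M 3, S.IsTorsionForm nabla T ∧
        T = ∑ i, (S.ηForm i).wedge (S.ηForm i).extD + (8 * (δ - α)) • S.η₁₂₃ ∧
        T = (2 * α) • ∑ i, (S.ηForm i).wedge (S.ΦH i) + (2 * (δ - 4 * α)) • S.η₁₂₃ ∧
        T.IsParallel nabla ∧
        T.extD = (4 * α ^ 2) • ∑ i, (S.Φ i).wedge (S.Φ i) +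
          (8 * α * (δ - α)) • ∑ i, (S.Φ i).wedge (S.η₂ (i + 1) (i + 2)) ∧
        T.extD = (4 * α ^ 2) • ∑ i, (S.ΦH i).wedge (S.ΦH i) +
          (8 * α * (δ - 2 * α)) • ∑ i, (S.ΦH i).wedge (S.η₂ (i + 1) (i + 2)) :=
  ⟨S.canonicalConnection α δ, hS.isCanonicalConnection,
    -- n ≥ 1 gives 4n + 3 > 3, hence a nonzero horizontal vector.
    fun _ h' _ _ hY ↦ hS.isCanonicalConnection.unique (by omega) h' hY,
    S.torsionForm α δ, AlmostThreeContactMetricStructure.isTorsionForm_canonicalConnection,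
    hS.torsionForm_eq, rfl,
    hS.isParallel_torsionForm
      AlmostThreeContactMetricStructure.isMetricConnection_canonicalConnection
      AlmostThreeContactMetricStructure.isTorsionForm_canonicalConnection,
    hS.extD_torsionForm, hS.extD_torsionForm'⟩
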